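/- Let $1\le k<d$ and let $\mathcal X$ be a probability law on $\mathbb R^d$ with mean zero, supported in the closed Euclidean unit ball, whose covariance matrix $A$ has eigenvalues $\lambda_1\ge\dots\ge\lambda_d$ with $\lambda:=\lambda_k>\bar\lambda:=\lambda_{k+1}$. Let $U\in\mathbb R^{d\times k}$ have as columns orthonormal eigenvectors for $\lambda_1,\dots,\lambda_k$. For $Q\in\mathbb R^{d\times k}$ with orthonormal columns put $\sin(U,Q)=\big(\max_{v\ne0}(1-\|U^\top Qv\|^2/\|v\|^2)\big)^{1/2}$. Given parameters $\delta_0\in(0,1)$, $\bar c>0$, $c>0$, let $$\tilde\lambda=\max(\bar\lambda,\lambda/4),\quad \gamma=(\tilde\lambda/\lambda)^{1/4},\quad \Delta=(\lambda-\tilde\lambda)/4,\quad \varepsilon_i=\sqrt{dk/\bar c}\;\gamma^i\ (i\ge0),$$ and, for $i\ge1$, $$\beta_i=\min\Big(\frac{\gamma}{\sqrt{1+\varepsilon_{i-1}^2}},\gamma\varepsilon_{i-1}\Big),\quad \delta_i=\frac{\delta_0}{2i^2},\quad |I_i|=\Big\lceil\frac{c}{(\Delta\beta_i)^2}\log\frac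 d{\delta_i}\Big\rceil .$$ The dynamic block power method (DBPCA) reads independent samples $x_1,x_2,\dots$ of $\mathcal X$, split into consecutive blocks $I_1,I_2,\dots$ of these sizes. It draws $S_0\in\mathbb R^{d\times k}$ with independent $\mathcal N(0,1)$ entries, takes a QR decomposition $S_0=Q_0R_0$ ($Q_0$ with orthonormal columns, $R_0$ upper triangular), and for $i=1,2,\dots$ forms $S_i=\frac1{|I_i|}\sum_{n\in I_i}x_nx_n^\top Q_{i-1}$ and takes a QR decomposition $S_i=Q_iR_i$. There is a universal constant $c_0>0$ such that for every $\delta_0\in(0,1)$ there is $\bar c_0>0$ such that for all $\bar c\in(0,\bar c_0]$ and $c\ge c_0$ there is a constant $C>0$, depending only on $\delta_0,\bar c,c$, with the following property. For all $d,k,\mathcal X$ as above and every $0<\varepsilon\le1/\sqrt{kd}$ there is an integer $L\ge1$ with $$L\le C\,\frac{\lambda}{\lambda-\bar\lambda}\log\frac d\varepsilon,\qquad N:=\sum_{i=1}^L|I_i|\le C\,\frac{\lambda\log(dL)}{\varepsilon^2(\lambda-\bar\lambda)^3},$$ such that, with probability at least $1-2\delta_0$, $\sin(U,Q_i)\le\varepsilon$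 for every $i\ge L$; in particular the error is at most $\varepsilon$ after $L$ iterations, which use $N$ samples in total. -/

import Mathlib

open MeasureTheory ProbabilityTheory Matrix

namespace DBPCA

noncomputable section

/-- The matrix `A` with entries `A i j = Cov(x i, x j)` for a random vector `x` with law `X` on
the Euclidean space of dimension `d`. -/
def covMatrix {d : ℕ} (X : Measure (EuclideanSpace ℝ (Fin d))) : Matrix (Fin d) (Fin d) ℝ :=
  Matrix.of fun i j => covariance (fun y => y i) (fun y => y j) X

/-- The assumptions on the law of one data point: it is a probability law with mean zero, carried
by the closed unit ball. -/
structure IsDataLaw {d : ℕ} (X : Measure (EuclideanSpace ℝ (Fin d))) : Prop where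
  isProbabilityMeasure : IsProbabilityMeasure X
  mean_zero : ∫ y, y ∂X = 0
  norm_le_one : ∀ᵐ y ∂X, ‖y‖ ≤ 1

/-- The columns of `V` form an orthonormal basis of eigenvectors of `A`, the eigenvalue of the
`j`-th column being `ev j`, and the eigenvalues are in non-increasing order, each of them listed
with its multiplicity. -/
structure IsSortedEigenbasis {d : ℕ} (A : Matrix (Fin d) (Fin d) ℝ) (ev : Fin d → ℝ)
    (V : Matrix (Fin d) (Fin d) ℝ) : Prop where
  antitone : Antitone ev
  orthonormal : Vᵀ * V = 1
  eigen : A * V = V * Matrix.diagonal ev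

/-- The `d × k` matrix consisting of the first `k` columns of `V`. -/
def firstCols {d k : ℕ} (hkd : k ≤ d) (V : Matrix (Fin d) (Fin d) ℝ) :
    Matrix (Fin d) (Fin k) ℝ :=
  V.submatrix id (Fin.castLE hkd)

/-- The error `Φ(U, Q)`: the maximum over nonzero `v` of `1 - ‖Uᵀ Q v‖² / ‖v‖²`
(Euclidean norms). -/
def errPhi {d k : ℕ} (U Q : Matrix (Fin d) (Fin k) ℝ) : ℝ :=
  ⨆ v : {v : Fin k → ℝ // v ≠ 0},
    (1 - ‖WithLp.toLp 2 ((Uᵀ * Q) *ᵥ v.1)‖ ^ 2 / ‖WithLp.toLp 2 v.1‖ ^ 2)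

/-- `sin(U, Q)`, the sine of the `k`-th (largest) principal angle between the column spaces of `U`
and `Q`, both with orthonormal columns. -/
def sinAngle {d k : ℕ} (U Q : Matrix (Fin d) (Fin k) ℝ) : ℝ :=
  Real.sqrt (errPhi U Q)

/-- `S = Q R` is a QR decomposition (of reduced form): `Q` has orthonormal columns and `R` is
upper triangular. -/
structure IsQR {d k : ℕ} (S Q : Matrix (Fin d) (Fin k) ℝ) (R : Matrix (Fin k) (Fin k) ℝ) :
    Prop where
  orthonormal : Qᵀ * Q = 1
  upper : ∀ i j, j < i → R i j = 0
  eq_mul : S = Q * R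

/-- One execution of the block power method with block sizes `size 1, size 2, …` on the initial
matrix `S₀` and the data points `x 1, x 2, …`: the matrix `Q i` is the estimate after `i` blocks,
and block `i + 1` consists of the `size (i + 1)` consecutive steps that follow the first `i`
blocks. Any QR decomposition may be chosen at each iteration. -/
structure IsRun {d k : ℕ} (size : ℕ → ℕ) (S₀ : Matrix (Fin d) (Fin k) ℝ)
    (x : ℕ → EuclideanSpace ℝ (Fin d)) (Q : ℕ → Matrix (Fin d) (Fin k) ℝ)
    (R : ℕ → Matrix (Fin k) (Fin k) ℝ) : Prop where
  init : IsQR S₀ (Q 0) (R 0)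
  step : ∀ i : ℕ,
    IsQR (∑ n ∈ Finset.Ioc (∑ j ∈ Finset.Icc 1 i, size j) (∑ j ∈ Finset.Icc 1 (i + 1), size j),
        (1 / (size (i + 1) : ℝ)) • (vecMulVec (x n).ofLp (x n).ofLp * Q i))
      (Q (i + 1)) (R (i + 1))

/-- `λ̃ = max(λ̄, λ/4)`. -/
def lamTilde (lam lamBar : ℝ) : ℝ := max lamBar (lam / 4)

/-- `γ = (λ̃/λ)^(1/4)`. -/
def gam (lam lamBar : ℝ) : ℝ := (lamTilde lam lamBar / lam) ^ (1 / 4 : ℝ)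

/-- `Δ = (λ - λ̃)/4`. -/
def gap (lam lamBar : ℝ) : ℝ := (lam - lamTilde lam lamBar) / 4

/-- `ε_i = ε_0 γ^i`, where `ε_0 = √(d k / c̄)`. -/
def errBound (d k : ℕ) (cbar lam lamBar : ℝ) (i : ℕ) : ℝ :=
  Real.sqrt ((d : ℝ) * k / cbar) * gam lam lamBar ^ i

/-- `β_i = min(γ / √(1 + ε_{i-1}²), γ ε_{i-1})`, for `i ≥ 1`. -/
def beta (d k : ℕ) (cbar lam lamBar : ℝ) (i : ℕ) : ℝ :=
  min (gam lam lamBar / Real.sqrt (1 + errBound d k cbar lam lamBar (i - 1) ^ 2))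
    (gam lam lamBar * errBound d k cbar lam lamBar (i - 1))

/-- `δ_i = δ_0 / (2 i²)`, for `i ≥ 1`. -/
def failProb (δ₀ : ℝ) (i : ℕ) : ℝ := δ₀ / (2 * (i : ℝ) ^ 2)

/-- The size `(c / (Δ β_i)²) log(d / δ_i)` of block `i ≥ 1`, rounded up to an integer. -/
def blockSize (d k : ℕ) (δ₀ cbar c lam lamBar : ℝ) (i : ℕ) : ℕ :=
  ⌈c / (gap lam lamBar * beta d k cbar lam lamBar i) ^ 2 * Real.log (d / failProb δ₀ i)⌉₊

end

end DBPCA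

/-!
Write `V = [U | W]` for the eigenbasis. The error is controlled through the tangent of the largest
principal angle between `U` and the current iterate (`TanLE`): the least `t` such that
`‖Wᵀ S w‖ ≤ t ‖Uᵀ S w‖` for all `w`. It depends only on the column space, so a QR decomposition
leaves it unchanged, and it dominates the sine.

*Iteration.* If a block has empirical matrix `B` with `‖B - A‖ ≤ η`, the tangent `t` becomes at most
`(λ̄ t + η √(1 + t²)) / (λ - η √(1 + t²))` (`TanLE.step`). For `η = Δ β_i` and `t = ε_{i-1}` this is
at most `γ ε_{i-1} = ε_i` (`step_ratio_le`).

*Concentration.* The matrix `x xᵀ` has Frobenius norm at most `1`, so a Hoeffding inequality for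
independent vectors in a Hilbert space, which is free of the dimension, bounds the Frobenius norm of
`B - A` and hence its operator norm (`IsDataLaw.measure_block_deviation_le`). The Hilbert space
inequality follows from
`cosh ‖s + x‖ ≤ cosh ‖s‖ cosh b + (a term linear in x)` for `‖x‖ ≤ b`, which holds because
`w ↦ cosh √w` is convex. The bound on `B - A` is uniform over the iterates, so no independence
between the iterates, or the initial matrix, and the data is needed.

*Initialization.* For a Gaussian `S` the tangent is of order `√(d k)` with probability close to one
(`measure_not_tanLE_gaussian_le`). For a fixed unit vector `a` the solution `y` of `Uᵀ S y = a` is a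
vector in the kernel of `(1 - a aᵀ) Uᵀ S` divided by a standard normal variable; the kernel is
independent of the rest of `S`, so `‖S y‖` is at most of order `√d` with high probability
(`measure_not_solvable_le`). Applied to the sign vectors `a = σ / √k`, this holds for most `σ`, and
by the Paley–Zygmund inequality for Rademacher sums (`card_signs_ge`) this majority of the `σ` tests
the operator norm of `S (Uᵀ S)⁻¹` up to the factor `√k` (`tanLE_of_card_badSign_lt`).

A union bound over the initialization and the blocks gives the failure probability `2 δ₀`, as
`∑ 1 / i² ≤ 2`. The iteration count `L` is the first index with `ε_L ≤ ε`, and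
`log (1 / γ) ≥ Δ / λ` bounds it; the block sizes are bounded by the geometric sequences `ε_i²` and
`ε_i⁻²`, whose sums bring the factor `1 / (1 - γ²) ≤ λ / (2 Δ)` into the bound on `N`.
-/

namespace DBPCA

/-! ### A dimension-free Hoeffding inequality in Hilbert space -/

/-- Convexity of `w ↦ cosh √w` on the segment from `(u - b)²` to `(u + b)²`. -/
lemma cosh_le_of_sq_eq {u b t z : ℝ} (ht : |t| ≤ 1) (hz : z ^ 2 = u ^ 2 + b ^ 2 + 2 * u * b * t) :
    Real.cosh z ≤ Real.cosh u * Real.cosh b + t * (Real.sinh u * Real.sinh b) := by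
  obtain ⟨h1, h2⟩ := abs_le.1 ht
  have hs : HasSum (fun n : ℕ => (1 + t) / 2 * ((u + b) ^ (2 * n) / ((2 * n).factorial : ℝ))
      + (1 - t) / 2 * ((u - b) ^ (2 * n) / ((2 * n).factorial : ℝ)))
      ((1 + t) / 2 * Real.cosh (u + b) + (1 - t) / 2 * Real.cosh (u - b)) :=
    ((Real.hasSum_cosh (u + b)).mul_left _).add ((Real.hasSum_cosh (u - b)).mul_left _)
  have hle := hasSum_le (fun n => ?_) (Real.hasSum_cosh z) hs
  · rw [Real.cosh_add, Real.cosh_sub] at hle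
    linarith
  · have hc := (convexOn_pow (𝕜 := ℝ) n).2 (Set.mem_Ici.2 (sq_nonneg (u + b)))
      (Set.mem_Ici.2 (sq_nonneg (u - b))) (show 0 ≤ (1 + t) / 2 by linarith)
      (show 0 ≤ (1 - t) / 2 by linarith) (by ring)
    simp only [smul_eq_mul] at hc
    have hzz : z ^ 2 = (1 + t) / 2 * (u + b) ^ 2 + (1 - t) / 2 * (u - b) ^ 2 := by
      rw [hz]; ring
    rw [pow_mul z, pow_mul (u + b), pow_mul (u - b), hzz]
    rw [← mul_div_assoc, ← mul_div_assoc, ← add_div]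
    gcongr

lemma ae_norm_sum_le {E Ω : Type*} [NormedAddCommGroup E] [MeasurableSpace Ω] {P : Measure Ω}
    {Y : ℕ → Ω → E} {b : ℝ} (hb : ∀ n, ∀ᵐ ω ∂P, ‖Y n ω‖ ≤ b) (s : Finset ℕ) :
    ∀ᵐ ω ∂P, ‖∑ n ∈ s, Y n ω‖ ≤ s.card * b := by
  filter_upwards [ae_all_iff.2 hb] with ω hω
  calc _ ≤ ∑ n ∈ s, ‖Y n ω‖ := norm_sum_le _ _
    _ ≤ ∑ n ∈ s, b := Finset.sum_le_sum fun n _ => hω n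
    _ = _ := by simp

lemma integrable_cosh_norm_sum {E Ω : Type*} [NormedAddCommGroup E] [MeasurableSpace E]
    [BorelSpace E] [SecondCountableTopology E] [MeasurableSpace Ω] {P : Measure Ω}
    [IsProbabilityMeasure P] {Y : ℕ → Ω → E} (hY : ∀ n, AEMeasurable (Y n) P) {b : ℝ}
    (hb : ∀ n, ∀ᵐ ω ∂P, ‖Y n ω‖ ≤ b) (s : Finset ℕ) :
    Integrable (fun ω => Real.cosh ‖∑ n ∈ s, Y n ω‖) P := by
  have hm : AEMeasurable (fun ω => ∑ n ∈ s, Y n ω) P :=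
    Finset.aemeasurable_fun_sum s fun n _ => hY n
  refine Integrable.of_bound (C := Real.cosh (s.card * b)) ?_ ?_
  · exact (Real.continuous_cosh.comp continuous_norm).measurable.comp_aemeasurable hm
      |>.aestronglyMeasurable
  · filter_upwards [ae_norm_sum_le hb s] with ω hω
    rw [Real.norm_eq_abs, abs_of_pos (Real.cosh_pos _)]
    apply Real.cosh_le_cosh.2
    rw [abs_of_nonneg (norm_nonneg _)]
    exact hω.trans (le_abs_self _)

section Hoeffding

variable {E : Type*} [NormedAddCommGroup E] [InnerProductSpace ℝ E]

/-- The one-step bound behind the Hilbert space Hoeffding inequality: the correction term is linear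
in the increment `x`, hence has mean zero when `x` is centred. -/
lemma cosh_norm_add_le {b : ℝ} (hb : 0 < b) (s x : E) (hx : ‖x‖ ≤ b) :
    Real.cosh ‖s + x‖ ≤ Real.cosh ‖s‖ * Real.cosh b +
      inner ℝ ((Real.sinh ‖s‖ / ‖s‖ * (Real.sinh b / b)) • s) x := by
  rcases eq_or_ne s 0 with rfl | hs
  · simp only [zero_add, norm_zero, Real.cosh_zero, one_mul, smul_zero, inner_zero_left, add_zero]
    exact Real.cosh_le_cosh.2 (by rwa [abs_of_nonneg (norm_nonneg _), abs_of_pos hb])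
  have hs' : 0 < ‖s‖ := norm_pos_iff.2 hs
  set t : ℝ := inner ℝ s x / (‖s‖ * b) with ht
  have hin : |inner ℝ s x| ≤ ‖s‖ * b :=
    (abs_real_inner_le_norm s x).trans (mul_le_mul_of_nonneg_left hx hs'.le)
  have ht1 : |t| ≤ 1 := by
    rw [ht, abs_div, abs_of_pos (mul_pos hs' hb), div_le_one (mul_pos hs' hb)]
    exact hin
  have hint : inner ℝ s x = ‖s‖ * b * t := by rw [ht]; field_simp
  have hnn : 0 ≤ ‖s‖ ^ 2 + b ^ 2 + 2 * ‖s‖ * b * t := by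
    obtain ⟨h1, -⟩ := abs_le.1 ht1
    nlinarith [sq_nonneg (‖s‖ - b), mul_pos hs' hb]
  have hle : ‖s + x‖ ≤ Real.sqrt (‖s‖ ^ 2 + b ^ 2 + 2 * ‖s‖ * b * t) := by
    apply Real.le_sqrt_of_sq_le
    rw [norm_add_sq_real, hint]
    have : ‖x‖ ^ 2 ≤ b ^ 2 := by gcongr
    linarith
  calc Real.cosh ‖s + x‖ ≤ Real.cosh (Real.sqrt (‖s‖ ^ 2 + b ^ 2 + 2 * ‖s‖ * b * t)) := by
        apply Real.cosh_le_cosh.2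
        rwa [abs_of_nonneg (norm_nonneg _), abs_of_nonneg (Real.sqrt_nonneg _)]
    _ ≤ _ := cosh_le_of_sq_eq ht1 (Real.sq_sqrt hnn)
    _ = _ := by
        rw [real_inner_smul_left, ht]
        field_simp

variable [MeasurableSpace E] [BorelSpace E] [SecondCountableTopology E] [CompleteSpace E]
  {Ω : Type*} [MeasurableSpace Ω] {P : Measure Ω} [IsProbabilityMeasure P]

lemma integral_cosh_norm_sum_le {Y : ℕ → Ω → E} (hY : ∀ n, AEMeasurable (Y n) P)
    (hind : iIndepFun Y P) {b : ℝ} (hb0 : 0 < b) (hb : ∀ n, ∀ᵐ ω ∂P, ‖Y n ω‖ ≤ b)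
    (hmean : ∀ n, ∫ ω, Y n ω ∂P = 0) (s : Finset ℕ) :
    ∫ ω, Real.cosh ‖∑ n ∈ s, Y n ω‖ ∂P ≤ Real.cosh b ^ s.card := by
  induction s using Finset.induction_on with
  | empty => simp
  | insert m s hms ih =>
    have hm : AEMeasurable (fun ω => ∑ n ∈ s, Y n ω) P :=
      Finset.aemeasurable_fun_sum s fun n _ => hY n
    set g : E → E := fun v => (Real.sinh ‖v‖ / ‖v‖ * (Real.sinh b / b)) • v with hg
    have hgm : Measurable g := by
      have h1 : Measurable fun v : E => Real.sinh ‖v‖ :=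
        (Real.continuous_sinh.comp continuous_norm).measurable
      exact ((h1.div measurable_norm).mul_const _).smul measurable_id
    have hgn : ∀ v, ‖g v‖ ≤ Real.sinh ‖v‖ * (Real.sinh b / b) := by
      intro v
      have h0 : 0 ≤ Real.sinh ‖v‖ := Real.sinh_nonneg_iff.2 (norm_nonneg v)
      have h1 : 0 ≤ Real.sinh b / b := div_nonneg (Real.sinh_nonneg_iff.2 hb0.le) hb0.le
      simp only [hg, norm_smul, norm_mul, norm_div, Real.norm_eq_abs, abs_norm]
      rw [abs_of_nonneg h0, ← abs_div, abs_of_nonneg h1]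
      rcases eq_or_ne v 0 with rfl | hv
      · simp
      · have : 0 < ‖v‖ := norm_pos_iff.2 hv
        apply le_of_eq; field_simp
    have hYint : Integrable (Y m) P :=
      Integrable.of_bound (hY m).aestronglyMeasurable b (hb m)
    have hgint : Integrable (fun ω => g (∑ n ∈ s, Y n ω)) P := by
      refine Integrable.of_bound (hgm.comp_aemeasurable hm).aestronglyMeasurable
        (Real.sinh (s.card * b) * (Real.sinh b / b)) ?_
      filter_upwards [ae_norm_sum_le hb s] with ω hω
      refine (hgn _).trans ?_
      have h1 : 0 ≤ Real.sinh b / b := div_nonneg (Real.sinh_nonneg_iff.2 hb0.le) hb0.le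
      gcongr
      exact Real.sinh_le_sinh.2 hω
    have hindep : IndepFun (fun ω => ∑ n ∈ s, Y n ω) (Y m) P := by
      have := hind.indepFun_finsetSum_of_notMem₀ hY hms
      convert this using 1
      ext ω; simp
    have hindep' : IndepFun (fun ω => g (∑ n ∈ s, Y n ω)) (Y m) P :=
      hindep.comp hgm measurable_id
    have hzero : ∫ ω, inner ℝ (g (∑ n ∈ s, Y n ω)) (Y m ω) ∂P = 0 := by
      have := hindep'.integral_bilin hgint hYint (innerSL ℝ)
      rw [hmean m, map_zero] at this
      exact this
    have hinner : Integrable (fun ω => (inner ℝ (g (∑ n ∈ s, Y n ω)) (Y m ω) : ℝ)) P := by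
      refine Integrable.mono' (g := fun ω => ‖g (∑ n ∈ s, Y n ω)‖ * b)
        (hgint.norm.mul_const b) ?_ ?_
      · exact hgint.aestronglyMeasurable.inner hYint.aestronglyMeasurable
      · filter_upwards [hb m] with ω hω
        exact (norm_inner_le_norm _ _).trans (by gcongr)
    calc ∫ ω, Real.cosh ‖∑ n ∈ insert m s, Y n ω‖ ∂P
        ≤ ∫ ω, (Real.cosh ‖∑ n ∈ s, Y n ω‖ * Real.cosh b
            + inner ℝ (g (∑ n ∈ s, Y n ω)) (Y m ω)) ∂P := by
          apply integral_mono_ae (integrable_cosh_norm_sum hY hb _)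
            (((integrable_cosh_norm_sum hY hb s).mul_const _).add hinner)
          filter_upwards [hb m] with ω hω
          rw [Finset.sum_insert hms, add_comm]
          exact cosh_norm_add_le hb0 _ _ hω
      _ = (∫ ω, Real.cosh ‖∑ n ∈ s, Y n ω‖ ∂P) * Real.cosh b := by
          rw [integral_add ((integrable_cosh_norm_sum hY hb s).mul_const _) hinner, hzero,
            integral_mul_const, add_zero]
      _ ≤ Real.cosh b ^ s.card * Real.cosh b := by gcongr
      _ = _ := by rw [Finset.card_insert_of_notMem hms, pow_succ]

/-- Hoeffding's inequality for sums of independent bounded centred random vectors in a Hilbert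
space. The bound does not depend on the dimension. -/
lemma measure_norm_sum_ge_le {Y : ℕ → Ω → E} (hY : ∀ n, AEMeasurable (Y n) P)
    (hind : iIndepFun Y P) {b : ℝ} (hb0 : 0 < b) (hb : ∀ n, ∀ᵐ ω ∂P, ‖Y n ω‖ ≤ b)
    (hmean : ∀ n, ∫ ω, Y n ω ∂P = 0) (s : Finset ℕ) (hs : s.Nonempty) {r : ℝ} (hr : 0 < r) :
    P.real {ω | r ≤ ‖∑ n ∈ s, Y n ω‖} ≤ 2 * Real.exp (-(r ^ 2 / (2 * s.card * b ^ 2))) := by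
  have hc : (0 : ℝ) < s.card := by exact_mod_cast hs.card_pos
  -- the exponent that minimizes the Chernoff bound `2 exp (n a² b² / 2 - a r)`
  set a : ℝ := r / (s.card * b ^ 2) with ha
  have ha0 : 0 < a := by positivity
  have hsum : ∀ ω, ∑ n ∈ s, a • Y n ω = a • ∑ n ∈ s, Y n ω := fun ω => Finset.smul_sum.symm
  have h1 : ∫ ω, Real.cosh ‖∑ n ∈ s, a • Y n ω‖ ∂P ≤ Real.cosh (a * b) ^ s.card := by
    refine integral_cosh_norm_sum_le (Y := fun n ω => a • Y n ω) (fun n => (hY n).const_smul a)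
      (hind.comp (fun _ v => a • v) fun _ => measurable_const_smul a) (mul_pos ha0 hb0)
      (fun n => ?_) (fun n => ?_) s
    · filter_upwards [hb n] with ω hω
      rw [norm_smul, Real.norm_eq_abs, abs_of_pos ha0]
      gcongr
    · rw [integral_smul, hmean, smul_zero]
  have hint : Integrable (fun ω => Real.cosh ‖∑ n ∈ s, a • Y n ω‖) P :=
    integrable_cosh_norm_sum (Y := fun n ω => a • Y n ω) (b := a * b)
      (fun n => (hY n).const_smul a) (fun n => by
        filter_upwards [hb n] with ω hω
        rw [norm_smul, Real.norm_eq_abs, abs_of_pos ha0]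
        gcongr) s
  have hmk := mul_meas_ge_le_integral_of_nonneg
    (Filter.Eventually.of_forall fun ω => (Real.cosh_pos _).le) hint (Real.exp (a * r) / 2)
  have hsub : P.real {ω | r ≤ ‖∑ n ∈ s, Y n ω‖} ≤
      P.real {ω | Real.exp (a * r) / 2 ≤ Real.cosh ‖∑ n ∈ s, a • Y n ω‖} := by
    refine measureReal_mono ?_ (measure_ne_top _ _)
    intro ω hω
    simp only [Set.mem_ofPred_eq] at hω ⊢
    rw [hsum, norm_smul, Real.norm_eq_abs, abs_of_pos ha0, Real.cosh_eq]
    have : Real.exp (a * r) ≤ Real.exp (a * ‖∑ n ∈ s, Y n ω‖) := by gcongr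
    have := Real.exp_pos (-(a * ‖∑ n ∈ s, Y n ω‖))
    linarith
  have hcosh : Real.cosh (a * b) ^ s.card ≤ Real.exp (a * r / 2) := by
    calc Real.cosh (a * b) ^ s.card ≤ Real.exp ((a * b) ^ 2 / 2) ^ s.card := by
          gcongr
          exact Real.cosh_le_exp_half_sq _
      _ = Real.exp (a * r / 2) := by
          rw [← Real.exp_nat_mul, ha]
          congr 1
          field_simp
  have hfin : Real.exp (a * r / 2) =
      Real.exp (a * r) * Real.exp (-(r ^ 2 / (2 * s.card * b ^ 2))) := by
    rw [← Real.exp_add, ha]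
    congr 1
    field_simp
    ring
  have hpos := Real.exp_pos (a * r)
  have : Real.exp (a * r) / 2 * P.real {ω | r ≤ ‖∑ n ∈ s, Y n ω‖} ≤
      Real.exp (a * r) * Real.exp (-(r ^ 2 / (2 * s.card * b ^ 2))) := by
    rw [← hfin]
    refine le_trans ?_ (hmk.trans (h1.trans hcosh))
    gcongr
  have h3 : Real.exp (a * r) * P.real {ω | r ≤ ‖∑ n ∈ s, Y n ω‖} ≤
      Real.exp (a * r) * (2 * Real.exp (-(r ^ 2 / (2 * s.card * b ^ 2)))) := by linarith
  exact le_of_mul_le_mul_left h3 hpos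

end Hoeffding

/-! ### Empirical second moment matrices -/

/-- The Euclidean norm of a vector given by its coordinates. -/
noncomputable def l2 {ι : Type*} [Fintype ι] (v : ι → ℝ) : ℝ := ‖WithLp.toLp 2 v‖

section l2

variable {ι κ : Type*} [Fintype ι] [Fintype κ]

lemma l2_nonneg (v : ι → ℝ) : 0 ≤ l2 v := norm_nonneg _

lemma l2_sq (v : ι → ℝ) : l2 v ^ 2 = ∑ i, v i ^ 2 := by
  rw [l2, EuclideanSpace.norm_sq_eq]; simp

lemma l2_sq_eq_dotProduct (v : ι → ℝ) : l2 v ^ 2 = v ⬝ᵥ v := by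
  rw [l2_sq, dotProduct]; simp [sq]

lemma l2_add_le (v w : ι → ℝ) : l2 (v + w) ≤ l2 v + l2 w := by
  rw [l2, WithLp.toLp_add]; exact norm_add_le _ _

lemma l2_sub_le (v w : ι → ℝ) : l2 v - l2 w ≤ l2 (v + w) := by
  have := norm_sub_norm_le (WithLp.toLp 2 v) (-(WithLp.toLp 2 w))
  rwa [norm_neg, sub_neg_eq_add] at this

lemma l2_smul (a : ℝ) (v : ι → ℝ) : l2 (a • v) = |a| * l2 v := by
  rw [l2, WithLp.toLp_smul, norm_smul, Real.norm_eq_abs]; rfl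

lemma l2_eq_zero {v : ι → ℝ} : l2 v = 0 ↔ v = 0 := by
  rw [l2, norm_eq_zero, WithLp.toLp_eq_zero]

lemma l2_zero : l2 (0 : ι → ℝ) = 0 := l2_eq_zero.2 rfl

lemma l2_pos {v : ι → ℝ} (hv : v ≠ 0) : 0 < l2 v :=
  (l2_nonneg v).lt_of_ne fun h => hv (l2_eq_zero.1 h.symm)

lemma dotProduct_sq_le (v w : ι → ℝ) : (v ⬝ᵥ w) ^ 2 ≤ l2 v ^ 2 * l2 w ^ 2 := by
  rw [l2_sq, l2_sq, dotProduct]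
  exact Finset.sum_mul_sq_le_sq_mul_sq _ _ _

/-- The operator norm is at most the Frobenius norm. -/
lemma l2_mulVec_le (F : Matrix ι κ ℝ) (v : κ → ℝ) :
    l2 (F *ᵥ v) ≤ l2 (fun p : ι × κ => F p.1 p.2) * l2 v := by
  apply le_of_sq_le_sq _ (mul_nonneg (l2_nonneg _) (l2_nonneg _))
  rw [mul_pow, l2_sq, l2_sq (fun p : ι × κ => F p.1 p.2), Fintype.sum_prod_type, Finset.sum_mul]
  refine Finset.sum_le_sum fun i _ => ?_
  have := dotProduct_sq_le (F i) v
  rwa [l2_sq] at this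

end l2

/-- The rank one matrix `y yᵀ` as a vector of the Hilbert space of matrices with the Frobenius
norm. -/
noncomputable def outerVec {d : ℕ} (y : EuclideanSpace ℝ (Fin d)) :
    EuclideanSpace ℝ (Fin d × Fin d) :=
  WithLp.toLp 2 fun p => y p.1 * y p.2

lemma norm_outerVec {d : ℕ} (y : EuclideanSpace ℝ (Fin d)) : ‖outerVec y‖ = ‖y‖ ^ 2 := by
  have h : ‖outerVec y‖ ^ 2 = (‖y‖ ^ 2) ^ 2 := by
    rw [EuclideanSpace.norm_sq_eq, EuclideanSpace.norm_sq_eq, Fintype.sum_prod_type, sq,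
      Finset.sum_mul_sum]
    simp [outerVec, mul_pow]
  exact (sq_eq_sq₀ (norm_nonneg _) (by positivity)).1 h

lemma continuous_outerVec {d : ℕ} : Continuous (outerVec (d := d)) := by
  unfold outerVec
  fun_prop

section Hoeffding

variable {E : Type*} [NormedAddCommGroup E] [InnerProductSpace ℝ E]
  [MeasurableSpace E] [BorelSpace E] [SecondCountableTopology E] [CompleteSpace E]
  {Ω : Type*} [MeasurableSpace Ω] {P : Measure Ω} [IsProbabilityMeasure P]

/-- Concentration of the average of independent random vectors in the unit ball. -/
lemma measure_norm_average_sub_ge_le {Z : ℕ → Ω → E} (hZ : ∀ n, AEMeasurable (Z n) P)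
    (hind : iIndepFun Z P) (hb : ∀ n, ∀ᵐ ω ∂P, ‖Z n ω‖ ≤ 1) {m : E}
    (hmean : ∀ n, ∫ ω, Z n ω ∂P = m) (s : Finset ℕ) (hs : s.Nonempty) {r : ℝ} (hr : 0 < r) :
    P.real {ω | r ≤ ‖∑ n ∈ s, (1 / (s.card : ℝ)) • Z n ω - m‖} ≤
      2 * Real.exp (-(s.card * r ^ 2 / 8)) := by
  have hc : (0 : ℝ) < s.card := by exact_mod_cast hs.card_pos
  have hint : ∀ n, Integrable (Z n) P := fun n =>
    Integrable.of_bound (hZ n).aestronglyMeasurable 1 (hb n)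
  have hm : ‖m‖ ≤ 1 := by
    rw [← hmean 0]
    simpa using norm_integral_le_of_norm_le_const (hb 0)
  have h := measure_norm_sum_ge_le (Y := fun n ω => Z n ω - m) (P := P) (b := 2)
    (fun n => (hZ n).sub_const m)
    (hind.comp (fun _ v => v - m) fun _ => measurable_id.sub_const m) (by norm_num)
    (fun n => by
      filter_upwards [hb n] with ω hω
      exact (norm_sub_le _ _).trans (by linarith))
    (fun n => by
      rw [integral_sub (hint n) (integrable_const m), hmean]; simp) s hs
    (r := s.card * r) (by positivity)
  have he : ((s.card : ℝ) * r) ^ 2 / (2 * s.card * 2 ^ 2) = s.card * r ^ 2 / 8 := by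
    field_simp; ring
  rw [he] at h
  convert h using 4 with ω
  have : ∑ n ∈ s, (Z n ω - m) = (s.card : ℝ) • (∑ n ∈ s, (1 / (s.card : ℝ)) • Z n ω - m) := by
    rw [Finset.sum_sub_distrib, ← Finset.smul_sum, smul_sub, smul_smul,
      mul_one_div_cancel hc.ne', one_smul, Finset.sum_const, Nat.cast_smul_eq_nsmul]
  rw [this, norm_smul, Real.norm_natCast, mul_le_mul_iff_right₀ hc]

end Hoeffding

section DataLaw

variable {d : ℕ} {X : Measure (EuclideanSpace ℝ (Fin d))}

lemma IsDataLaw.integrable_id (hX : IsDataLaw X) : Integrable (fun y => y) X := by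
  have := hX.isProbabilityMeasure
  exact Integrable.of_bound measurable_id.aestronglyMeasurable 1 hX.norm_le_one

lemma IsDataLaw.integral_coord (hX : IsDataLaw X) (i : Fin d) : ∫ y, y i ∂X = 0 := by
  have h := (EuclideanSpace.proj (𝕜 := ℝ) i).integral_comp_comm hX.integrable_id
  simpa [hX.mean_zero] using h

lemma IsDataLaw.covMatrix_apply (hX : IsDataLaw X) (i j : Fin d) :
    covMatrix X i j = ∫ y, y i * y j ∂X := by
  simp [covMatrix, covariance, hX.integral_coord]

lemma IsDataLaw.norm_outerVec_le (hX : IsDataLaw X) : ∀ᵐ y ∂X, ‖outerVec y‖ ≤ 1 := by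
  filter_upwards [hX.norm_le_one] with y hy
  rw [norm_outerVec]
  exact pow_le_one₀ (norm_nonneg _) hy

lemma IsDataLaw.integrable_outerVec (hX : IsDataLaw X) : Integrable outerVec X := by
  have := hX.isProbabilityMeasure
  exact Integrable.of_bound continuous_outerVec.measurable.aestronglyMeasurable 1
    hX.norm_outerVec_le

lemma IsDataLaw.integral_outerVec (hX : IsDataLaw X) :
    ∫ y, outerVec y ∂X = WithLp.toLp 2 fun p : Fin d × Fin d => covMatrix X p.1 p.2 := by
  ext p
  have h := (EuclideanSpace.proj (𝕜 := ℝ) p).integral_comp_comm hX.integrable_outerVec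
  exact h.symm.trans (hX.covMatrix_apply p.1 p.2).symm

lemma IsDataLaw.integrable_coord_mul (hX : IsDataLaw X) (i j : Fin d) :
    Integrable (fun y : EuclideanSpace ℝ (Fin d) => y i * y j) X :=
  (EuclideanSpace.proj (𝕜 := ℝ) (i, j)).integrable_comp hX.integrable_outerVec

lemma IsDataLaw.quadForm_eq (hX : IsDataLaw X) (v : Fin d → ℝ) :
    v ⬝ᵥ (covMatrix X *ᵥ v) = ∫ y, (v ⬝ᵥ y.ofLp) ^ 2 ∂X := by
  have h1 : ∀ y : EuclideanSpace ℝ (Fin d),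
      (v ⬝ᵥ y.ofLp) ^ 2 = ∑ i, ∑ j, v i * v j * (y i * y j) := by
    intro y
    rw [sq, dotProduct, Finset.sum_mul_sum]
    exact Finset.sum_congr rfl fun i _ => Finset.sum_congr rfl fun j _ => by ring
  simp_rw [h1]
  rw [integral_finsetSum _ fun i _ => integrable_finsetSum _ fun j _ =>
    (hX.integrable_coord_mul i j).const_mul _]
  rw [dotProduct]
  refine Finset.sum_congr rfl fun i _ => ?_
  rw [integral_finsetSum _ fun j _ => (hX.integrable_coord_mul i j).const_mul _, mulVec, dotProduct,
    Finset.mul_sum]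
  refine Finset.sum_congr rfl fun j _ => ?_
  rw [integral_const_mul, hX.covMatrix_apply]
  ring

lemma IsDataLaw.quadForm_nonneg (hX : IsDataLaw X) (v : Fin d → ℝ) :
    0 ≤ v ⬝ᵥ (covMatrix X *ᵥ v) := by
  rw [hX.quadForm_eq]
  exact integral_nonneg fun y => sq_nonneg _

lemma IsDataLaw.quadForm_le (hX : IsDataLaw X) (v : Fin d → ℝ) :
    v ⬝ᵥ (covMatrix X *ᵥ v) ≤ l2 v ^ 2 := by
  have := hX.isProbabilityMeasure
  rw [hX.quadForm_eq]
  have h := norm_integral_le_of_norm_le_const (μ := X) (C := l2 v ^ 2)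
    (f := fun y : EuclideanSpace ℝ (Fin d) => (v ⬝ᵥ y.ofLp) ^ 2) (by
      filter_upwards [hX.norm_le_one] with y hy
      rw [Real.norm_eq_abs, abs_of_nonneg (sq_nonneg _)]
      refine (dotProduct_sq_le v y.ofLp).trans ?_
      have : l2 y.ofLp ^ 2 ≤ 1 := pow_le_one₀ (l2_nonneg _) hy
      nlinarith [sq_nonneg (l2 v)])
  rw [probReal_univ, mul_one] at h
  exact (le_abs_self _).trans h

lemma covMatrix_transpose : (covMatrix X)ᵀ = covMatrix X := by
  ext i j
  exact covariance_comm _ _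

/-- The empirical second moment matrix of a block of data points is close to the covariance matrix
in operator norm. Bounding the operator norm by the Frobenius norm loses nothing here, because
`y yᵀ` has Frobenius norm at most `1`. -/
lemma IsDataLaw.measure_block_deviation_le (hX : IsDataLaw X) {Ω : Type*} [MeasurableSpace Ω]
    {P : Measure Ω} [IsProbabilityMeasure P] {x : ℕ → Ω → EuclideanSpace ℝ (Fin d)}
    (hx : ∀ n, HasLaw (x n) X P) (hind : iIndepFun x P) (s : Finset ℕ) (hs : s.Nonempty) {r : ℝ}
    (hr : 0 < r) :
    P {ω | ¬ ∀ v, l2 ((∑ n ∈ s, (1 / (s.card : ℝ)) • vecMulVec (x n ω).ofLp (x n ω).ofLp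
        - covMatrix X) *ᵥ v) ≤ r * l2 v} ≤
      ENNReal.ofReal (2 * Real.exp (-(s.card * r ^ 2 / 8))) := by
  have h := measure_norm_average_sub_ge_le (Z := fun n ω => outerVec (x n ω)) (P := P)
    (fun n => continuous_outerVec.measurable.comp_aemeasurable (hx n).aemeasurable)
    (hind.comp (fun _ => outerVec) fun _ => continuous_outerVec.measurable)
    (fun n => by
      have := (hx n).ae_iff (p := fun y => ‖outerVec y‖ ≤ 1)
        (measurableSet_le continuous_outerVec.measurable.norm measurable_const).mem
      exact this.2 hX.norm_outerVec_le)
    (m := WithLp.toLp 2 fun p : Fin d × Fin d => covMatrix X p.1 p.2)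
    (fun n => by
      rw [← hX.integral_outerVec]
      exact (hx n).integral_comp hX.integrable_outerVec.aestronglyMeasurable) s hs hr
  refine le_trans (measure_mono ?_)
    ((ENNReal.le_ofReal_iff_toReal_le (measure_ne_top _ _) (by positivity)).2 h)
  intro ω hω
  simp only [Set.mem_ofPred_eq] at hω ⊢
  by_contra hlt
  apply hω
  intro v
  refine (l2_mulVec_le _ v).trans (mul_le_mul_of_nonneg_right ?_ (l2_nonneg v))
  refine le_trans (le_of_eq ?_) (not_le.1 hlt).le
  rw [l2]
  congr 1
  ext p
  simp [outerVec, Matrix.sum_apply, vecMulVec_apply, Matrix.sub_apply]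

end DataLaw

/-! ### Principal angles and one perturbed power iteration -/

section Splitting

variable {d k : ℕ} {κ : Type*} [Fintype κ] {A : Matrix (Fin d) (Fin d) ℝ}
  {U : Matrix (Fin d) (Fin k) ℝ} {W : Matrix (Fin d) κ ℝ} {lam lamBar : ℝ}

/-- The columns of `U` and `W` together are an orthonormal basis, adapted to the symmetric matrix
`A`: it expands the span of `U` by at least `lam` and the span of `W` by at most `lamBar`. -/
structure SpectralSplit (A : Matrix (Fin d) (Fin d) ℝ) (U : Matrix (Fin d) (Fin k) ℝ)
    (W : Matrix (Fin d) κ ℝ) (lam lamBar : ℝ) : Prop where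
  pythagoras : ∀ x, l2 (Uᵀ *ᵥ x) ^ 2 + l2 (Wᵀ *ᵥ x) ^ 2 = l2 x ^ 2
  le_head : ∀ x, lam * l2 (Uᵀ *ᵥ x) ≤ l2 (Uᵀ *ᵥ (A *ᵥ x))
  tail_le : ∀ x, l2 (Wᵀ *ᵥ (A *ᵥ x)) ≤ lamBar * l2 (Wᵀ *ᵥ x)

lemma SpectralSplit.head_le_norm (h : SpectralSplit A U W lam lamBar) (x : Fin d → ℝ) :
    l2 (Uᵀ *ᵥ x) ≤ l2 x :=
  le_of_sq_le_sq (by have := h.pythagoras x; nlinarith [sq_nonneg (l2 (Wᵀ *ᵥ x))]) (l2_nonneg _)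

lemma SpectralSplit.tail_le_norm (h : SpectralSplit A U W lam lamBar) (x : Fin d → ℝ) :
    l2 (Wᵀ *ᵥ x) ≤ l2 x :=
  le_of_sq_le_sq (by have := h.pythagoras x; nlinarith [sq_nonneg (l2 (Uᵀ *ᵥ x))]) (l2_nonneg _)

/-- The tangent of the largest principal angle between the column spaces of `S` and `U` is at most
`t`, and `S` has full column rank. The columns of `W` span the orthogonal complement of those of
`U`. -/
structure TanLE (U : Matrix (Fin d) (Fin k) ℝ) (W : Matrix (Fin d) κ ℝ)
    (S : Matrix (Fin d) (Fin k) ℝ) (t : ℝ) : Prop where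
  inj : ∀ w, Uᵀ *ᵥ (S *ᵥ w) = 0 → w = 0
  le : ∀ w, l2 (Wᵀ *ᵥ (S *ᵥ w)) ≤ t * l2 (Uᵀ *ᵥ (S *ᵥ w))

/-- The tangent depends only on the column space. -/
lemma TanLE.of_isQR {S Q : Matrix (Fin d) (Fin k) ℝ} {R : Matrix (Fin k) (Fin k) ℝ} {t : ℝ}
    (h : TanLE U W S t) (hqr : IsQR S Q R) : TanLE U W Q t := by
  have hS : ∀ w, S *ᵥ w = Q *ᵥ (R *ᵥ w) := fun w => by rw [hqr.eq_mul, mulVec_mulVec]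
  have hinj : Function.Injective R.mulVecLin := by
    rw [← LinearMap.ker_eq_bot, LinearMap.ker_eq_bot']
    intro w hw
    rw [mulVecLin_apply] at hw
    exact h.inj w (by rw [hS, hw, mulVec_zero, mulVec_zero])
  have hsurj : ∀ v, ∃ w, R *ᵥ w = v := LinearMap.injective_iff_surjective.1 hinj
  constructor
  · intro v hv
    obtain ⟨w, rfl⟩ := hsurj v
    rw [← hS] at hv
    rw [h.inj w hv, mulVec_zero]
  · intro v
    obtain ⟨w, rfl⟩ := hsurj v
    rw [← hS]
    exact h.le w

lemma TanLE.mono {S : Matrix (Fin d) (Fin k) ℝ} {t t' : ℝ} (h : TanLE U W S t) (htt : t ≤ t') :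
    TanLE U W S t' :=
  ⟨h.inj, fun w => (h.le w).trans (mul_le_mul_of_nonneg_right htt (l2_nonneg _))⟩

lemma l2_mulVec_of_orthonormal {Q : Matrix (Fin d) (Fin k) ℝ} (hQ : Qᵀ * Q = 1) (w : Fin k → ℝ) :
    l2 (Q *ᵥ w) = l2 w := by
  have h : l2 (Q *ᵥ w) ^ 2 = l2 w ^ 2 := by
    rw [l2_sq_eq_dotProduct, l2_sq_eq_dotProduct, dotProduct_mulVec, ← mulVec_transpose,
      mulVec_mulVec, hQ, one_mulVec]
  exact (sq_eq_sq₀ (l2_nonneg _) (l2_nonneg _)).1 h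

lemma TanLE.norm_le (h : SpectralSplit A U W lam lamBar) {Q : Matrix (Fin d) (Fin k) ℝ} {t : ℝ}
    (hQ : Qᵀ * Q = 1) (hT : TanLE U W Q t) (w : Fin k → ℝ) :
    l2 w ≤ Real.sqrt (1 + t ^ 2) * l2 (Uᵀ *ᵥ (Q *ᵥ w)) := by
  apply le_of_sq_le_sq _ (mul_nonneg (Real.sqrt_nonneg _) (l2_nonneg _))
  rw [mul_pow, Real.sq_sqrt (by positivity), ← l2_mulVec_of_orthonormal hQ, ← h.pythagoras]
  have := pow_le_pow_left₀ (l2_nonneg _) (hT.le w) 2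
  rw [mul_pow] at this
  linarith

/-- One iteration of the power method with a perturbed matrix `B`: the tangent `t` becomes at most
`(λ̄ t + η √(1 + t²)) / (λ - η √(1 + t²))`. -/
lemma TanLE.step (h : SpectralSplit A U W lam lamBar) {Q : Matrix (Fin d) (Fin k) ℝ}
    {B : Matrix (Fin d) (Fin d) ℝ} {t η : ℝ} (hl : 0 ≤ lamBar) (hη : 0 ≤ η)
    (hQ : Qᵀ * Q = 1) (hT : TanLE U W Q t) (hB : ∀ v, l2 ((B - A) *ᵥ v) ≤ η * l2 v)
    (hlt : η * Real.sqrt (1 + t ^ 2) < lam) :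
    TanLE U W (B * Q) ((lamBar * t + η * Real.sqrt (1 + t ^ 2)) /
      (lam - η * Real.sqrt (1 + t ^ 2))) := by
  set ρ := Real.sqrt (1 + t ^ 2)
  have hpos : 0 < lam - η * ρ := by linarith
  have hdec : ∀ w, (B * Q) *ᵥ w = A *ᵥ (Q *ᵥ w) + (B - A) *ᵥ (Q *ᵥ w) := by
    intro w
    rw [← add_mulVec, add_sub_cancel, mulVec_mulVec w B Q]
  have hpert : ∀ w, l2 ((B - A) *ᵥ (Q *ᵥ w)) ≤ η * ρ * l2 (Uᵀ *ᵥ (Q *ᵥ w)) := by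
    intro w
    refine (hB _).trans ?_
    rw [l2_mulVec_of_orthonormal hQ, mul_assoc]
    exact mul_le_mul_of_nonneg_left (hT.norm_le h hQ w) hη
  have hhead : ∀ w, (lam - η * ρ) * l2 (Uᵀ *ᵥ (Q *ᵥ w)) ≤ l2 (Uᵀ *ᵥ ((B * Q) *ᵥ w)) := by
    intro w
    rw [hdec, mulVec_add]
    have h1 := l2_sub_le (Uᵀ *ᵥ (A *ᵥ (Q *ᵥ w))) (Uᵀ *ᵥ ((B - A) *ᵥ (Q *ᵥ w)))
    have h2 := h.le_head (Q *ᵥ w)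
    have h3 := (h.head_le_norm ((B - A) *ᵥ (Q *ᵥ w))).trans (hpert w)
    linarith
  constructor
  · intro w hw
    apply hT.inj w
    have h1 := hhead w
    rw [hw, l2_zero] at h1
    exact l2_eq_zero.1 (le_antisymm (nonpos_of_mul_nonpos_right h1 hpos) (l2_nonneg _))
  · intro w
    have h1 : l2 (Wᵀ *ᵥ ((B * Q) *ᵥ w)) ≤ (lamBar * t + η * ρ) * l2 (Uᵀ *ᵥ (Q *ᵥ w)) := by
      rw [hdec, mulVec_add]
      refine (l2_add_le _ _).trans ?_
      have h2 := (h.tail_le (Q *ᵥ w)).trans (mul_le_mul_of_nonneg_left (hT.le w) hl)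
      have h3 := (h.tail_le_norm ((B - A) *ᵥ (Q *ᵥ w))).trans (hpert w)
      linarith
    rcases eq_or_ne w 0 with rfl | hw
    · simp [l2_zero]
    have hp : 0 < l2 (Uᵀ *ᵥ (Q *ᵥ w)) := l2_pos fun h0 => hw (hT.inj w h0)
    have hnn : 0 ≤ lamBar * t + η * ρ := by
      by_contra hneg
      exact absurd ((l2_nonneg _).trans h1) (not_le.2 (mul_neg_of_neg_of_pos (not_le.1 hneg) hp))
    calc _ ≤ (lamBar * t + η * ρ) * l2 (Uᵀ *ᵥ (Q *ᵥ w)) := h1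
      _ = (lamBar * t + η * ρ) / (lam - η * ρ) * ((lam - η * ρ) * l2 (Uᵀ *ᵥ (Q *ᵥ w))) := by
          field_simp
      _ ≤ _ := mul_le_mul_of_nonneg_left (hhead w) (div_nonneg hnn hpos.le)

lemma TanLE.sinAngle_le (h : SpectralSplit A U W lam lamBar) {Q : Matrix (Fin d) (Fin k) ℝ} {t : ℝ}
    (ht : 0 ≤ t) (hQ : Qᵀ * Q = 1) (hT : TanLE U W Q t) : sinAngle U Q ≤ t := by
  refine Real.sqrt_le_iff.2 ⟨ht, Real.iSup_le (fun ⟨v, hv⟩ => ?_) (sq_nonneg t)⟩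
  change 1 - l2 ((Uᵀ * Q) *ᵥ v) ^ 2 / l2 v ^ 2 ≤ t ^ 2
  have hv0 : 0 < l2 v ^ 2 := pow_pos (l2_pos hv) 2
  rw [← mulVec_mulVec, ← div_self hv0.ne', ← sub_div, div_le_iff₀ hv0]
  have h1 := h.pythagoras (Q *ᵥ v)
  rw [l2_mulVec_of_orthonormal hQ] at h1
  have h2 := pow_le_pow_left₀ (l2_nonneg _) (hT.le v) 2
  rw [mul_pow] at h2
  have h3 : t ^ 2 * l2 (Uᵀ *ᵥ (Q *ᵥ v)) ^ 2 ≤ t ^ 2 * l2 v ^ 2 := by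
    apply mul_le_mul_of_nonneg_left _ (sq_nonneg t)
    linarith [sq_nonneg (l2 (Wᵀ *ᵥ (Q *ᵥ v)))]
  linarith

end Splitting

section Eigenbasis

variable {d k : ℕ} {A V : Matrix (Fin d) (Fin d) ℝ} {ev : Fin d → ℝ}

/-- The columns of `V` with index at least `k`. -/
def lastCols (k : ℕ) (V : Matrix (Fin d) (Fin d) ℝ) :
    Matrix (Fin d) {i : Fin d // k ≤ (i : ℕ)} ℝ :=
  V.submatrix id Subtype.val

lemma sum_castLE_add_sum_subtype (hkd : k ≤ d) (f : Fin d → ℝ) :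
    ∑ j : Fin k, f (Fin.castLE hkd j) + ∑ i : {i : Fin d // k ≤ (i : ℕ)}, f i = ∑ i, f i := by
  have h1 : ∑ j : Fin k, f (Fin.castLE hkd j) = ∑ i with ¬ k ≤ ((i : Fin d) : ℕ), f i := by
    refine Finset.sum_bij (fun j _ => Fin.castLE hkd j) ?_ ?_ ?_ ?_
    · intro j _; simp
    · intro a _ b _ hab; exact Fin.castLE_injective hkd hab
    · intro b hb
      have hb' : (b : ℕ) < k := by simpa using hb
      exact ⟨⟨b, hb'⟩, Finset.mem_univ _, rfl⟩
    · intros; rfl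
  rw [h1, ← Finset.sum_subtype (Finset.univ.filter fun i : Fin d => k ≤ (i : ℕ)) (by simp) f,
    add_comm, Finset.sum_filter_add_sum_filter_not]

lemma IsSortedEigenbasis.mul_transpose (h : IsSortedEigenbasis A ev V) : V * Vᵀ = 1 :=
  mul_eq_one_comm.1 h.orthonormal

lemma IsSortedEigenbasis.transpose_mulVec (h : IsSortedEigenbasis A ev V) (hA : Aᵀ = A)
    (x : Fin d → ℝ) (i : Fin d) : (Vᵀ *ᵥ (A *ᵥ x)) i = ev i * (Vᵀ *ᵥ x) i := by
  have h1 : Vᵀ * A = diagonal ev * Vᵀ := by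
    have := congrArg Matrix.transpose h.eigen
    rwa [transpose_mul, transpose_mul, hA, diagonal_transpose] at this
  rw [mulVec_mulVec, h1, ← mulVec_mulVec, mulVec_diagonal]

lemma IsSortedEigenbasis.spectralSplit (h : IsSortedEigenbasis A ev V) (hA : Aᵀ = A)
    (hkd : k ≤ d) (hev : ∀ i, 0 ≤ ev i) {i j : Fin d} (hi : (i : ℕ) + 1 = k) (hj : (j : ℕ) = k) :
    SpectralSplit A (firstCols hkd V) (lastCols k V) (ev i) (ev j) := by
  have hfst : ∀ x j, ((firstCols hkd V)ᵀ *ᵥ x) j = (Vᵀ *ᵥ x) (Fin.castLE hkd j) :=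
    fun _ _ => rfl
  have hlst : ∀ x j, ((lastCols k V)ᵀ *ᵥ x) j = (Vᵀ *ᵥ x) (j : Fin d) := fun _ _ => rfl
  refine ⟨fun x => ?_, fun x => ?_, fun x => ?_⟩
  · rw [l2_sq, l2_sq]
    simp_rw [hfst, hlst]
    rw [sum_castLE_add_sum_subtype hkd fun i => (Vᵀ *ᵥ x) i ^ 2, ← l2_sq]
    congr 1
    exact l2_mulVec_of_orthonormal (by rw [transpose_transpose, h.mul_transpose]) x
  · apply le_of_sq_le_sq _ (l2_nonneg _)
    rw [mul_pow, l2_sq, l2_sq, Finset.mul_sum]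
    refine Finset.sum_le_sum fun l _ => ?_
    rw [hfst, hfst, h.transpose_mulVec hA, mul_pow]
    gcongr
    · exact hev _
    · apply h.antitone
      rw [Fin.le_def]
      have := l.2
      simp only [Fin.val_castLE]
      omega
  · apply le_of_sq_le_sq _ (mul_nonneg (hev _) (l2_nonneg _))
    rw [mul_pow, l2_sq, l2_sq, Finset.mul_sum]
    refine Finset.sum_le_sum fun l _ => ?_
    rw [hlst, hlst, h.transpose_mulVec hA, mul_pow]
    gcongr
    · exact hev _
    · exact h.antitone (Fin.le_def.2 (hj.le.trans l.2))

lemma IsSortedEigenbasis.quadForm_col (h : IsSortedEigenbasis A ev V) (i : Fin d) :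
    (V.col i) ⬝ᵥ (A *ᵥ V.col i) = ev i ∧ l2 (V.col i) ^ 2 = 1 := by
  have h1 : V.col i ⬝ᵥ V.col i = 1 := by
    have := congrFun (congrFun h.orthonormal i) i
    rwa [one_apply_eq] at this
  have h2 : A *ᵥ V.col i = ev i • V.col i := by
    ext j
    have := congrFun (congrFun h.eigen j) i
    rw [mul_diagonal, mul_comm] at this
    exact this
  rw [h2, dotProduct_smul, h1, smul_eq_mul, mul_one, l2_sq_eq_dotProduct, h1]
  exact ⟨rfl, rfl⟩

lemma IsDataLaw.eigenvalue_nonneg {X : Measure (EuclideanSpace ℝ (Fin d))} (hX : IsDataLaw X)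
    (h : IsSortedEigenbasis (covMatrix X) ev V) (i : Fin d) : 0 ≤ ev i := by
  rw [← (h.quadForm_col i).1]
  exact hX.quadForm_nonneg _

lemma IsDataLaw.eigenvalue_le_one {X : Measure (EuclideanSpace ℝ (Fin d))} (hX : IsDataLaw X)
    (h : IsSortedEigenbasis (covMatrix X) ev V) (i : Fin d) : ev i ≤ 1 := by
  rw [← (h.quadForm_col i).1, ← (h.quadForm_col i).2]
  exact hX.quadForm_le _

lemma firstCols_orthonormal (hkd : k ≤ d) (hV : Vᵀ * V = 1) :
    (firstCols hkd V)ᵀ * firstCols hkd V = 1 := by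
  ext i j
  have := congrFun (congrFun hV (Fin.castLE hkd i)) (Fin.castLE hkd j)
  simp only [one_apply, (Fin.castLE_injective hkd).eq_iff] at this
  rw [one_apply]
  exact this

end Eigenbasis

/-! ### Sign vectors as test vectors -/

section Signs

/-- The vector of signs `±1` encoded by a Boolean vector. -/
def signVec {n : ℕ} (σ : Fin n → Bool) : Fin n → ℝ := fun i => if σ i then 1 else -1

lemma signVec_sq {n : ℕ} (σ : Fin n → Bool) (i : Fin n) : signVec σ i ^ 2 = 1 := by
  unfold signVec; split_ifs <;> norm_num

lemma sum_signs_succ {n : ℕ} (v : Fin (n + 1) → ℝ) (f : ℝ → ℝ) :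
    ∑ σ : Fin (n + 1) → Bool, f (v ⬝ᵥ signVec σ) =
      ∑ τ : Fin n → Bool, (f (Fin.tail v ⬝ᵥ signVec τ + v 0) +
        f (Fin.tail v ⬝ᵥ signVec τ - v 0)) := by
  rw [← (Fin.consEquiv fun _ => Bool).sum_comp, Fintype.sum_prod_type, Fintype.sum_bool,
    ← Finset.sum_add_distrib]
  refine Finset.sum_congr rfl fun τ _ => ?_
  congr 2 <;>
  · simp only [dotProduct, Fin.sum_univ_succ, signVec, Fin.consEquiv, Equiv.coe_fn_mk,
      Fin.cons_zero, Fin.cons_succ, Fin.tail]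
    simp
    ring

lemma sum_signs_sq {n : ℕ} (v : Fin n → ℝ) :
    ∑ σ : Fin n → Bool, (v ⬝ᵥ signVec σ) ^ 2 = 2 ^ n * l2 v ^ 2 := by
  induction n with
  | zero => simp [l2_sq]
  | succ n ih =>
    rw [sum_signs_succ v (fun x => x ^ 2)]
    have h1 : ∀ τ : Fin n → Bool, (Fin.tail v ⬝ᵥ signVec τ + v 0) ^ 2 +
        (Fin.tail v ⬝ᵥ signVec τ - v 0) ^ 2 = 2 * (Fin.tail v ⬝ᵥ signVec τ) ^ 2 + 2 * v 0 ^ 2 :=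
      fun τ => by ring
    simp_rw [h1]
    rw [Finset.sum_add_distrib, ← Finset.mul_sum, ih, l2_sq, l2_sq, Fin.sum_univ_succ]
    simp [Fin.tail]
    ring

lemma sum_signs_fourth_le {n : ℕ} (v : Fin n → ℝ) :
    ∑ σ : Fin n → Bool, (v ⬝ᵥ signVec σ) ^ 4 ≤ 2 ^ n * (3 * (l2 v ^ 2) ^ 2) := by
  induction n with
  | zero => simp [l2_sq]
  | succ n ih =>
    rw [sum_signs_succ v (fun x => x ^ 4)]
    have h1 : ∀ τ : Fin n → Bool, (Fin.tail v ⬝ᵥ signVec τ + v 0) ^ 4 +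
        (Fin.tail v ⬝ᵥ signVec τ - v 0) ^ 4 = 2 * (Fin.tail v ⬝ᵥ signVec τ) ^ 4 +
        12 * v 0 ^ 2 * (Fin.tail v ⬝ᵥ signVec τ) ^ 2 + 2 * v 0 ^ 4 :=
      fun τ => by ring
    simp_rw [h1]
    rw [Finset.sum_add_distrib, Finset.sum_add_distrib, ← Finset.mul_sum, ← Finset.mul_sum,
      sum_signs_sq]
    have h2 : l2 v ^ 2 = v 0 ^ 2 + l2 (Fin.tail v) ^ 2 := by
      rw [l2_sq, l2_sq, Fin.sum_univ_succ]; rfl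
    have h3 := ih (Fin.tail v)
    rw [h2]
    simp only [Finset.sum_const, Finset.card_univ, Fintype.card_fun, Fintype.card_bool,
      Fintype.card_fin, nsmul_eq_mul, Nat.cast_pow, Nat.cast_ofNat]
    have h4 : (0 : ℝ) ≤ 2 ^ n * v 0 ^ 4 := by positivity
    rw [pow_succ (2 : ℝ) n]
    linarith

/-- Anticoncentration of Rademacher sums (Paley–Zygmund): a proportion at least `3/16` of the sign
vectors has an inner product with `v` of size at least `|v| / 2`. -/
lemma card_signs_ge {n : ℕ} (v : Fin n → ℝ) (hv : v ≠ 0) :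
    3 / 16 * (2 : ℝ) ^ n ≤
      ((Finset.univ.filter fun σ : Fin n → Bool =>
        l2 v ^ 2 / 4 ≤ (v ⬝ᵥ signVec σ) ^ 2).card : ℝ) := by
  set s := l2 v ^ 2
  have hs : 0 < s := pow_pos (l2_pos hv) 2
  -- the quadratic polynomial in `X²` on the left is a lower bound for the indicator function
  have hpt : ∀ σ : Fin n → Bool, s / 2 * ((v ⬝ᵥ signVec σ) ^ 2 - s / 4)
      - (v ⬝ᵥ signVec σ) ^ 4 / 16 ≤
      if s / 4 ≤ (v ⬝ᵥ signVec σ) ^ 2 then s ^ 2 else 0 := by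
    intro σ
    split_ifs with h
    · nlinarith [sq_nonneg ((v ⬝ᵥ signVec σ) ^ 2 - 4 * s)]
    · have : (v ⬝ᵥ signVec σ) ^ 2 - s / 4 < 0 := by linarith
      nlinarith [sq_nonneg ((v ⬝ᵥ signVec σ) ^ 2)]
  have hsum := Finset.sum_le_sum fun σ (_ : σ ∈ Finset.univ) => hpt σ
  rw [Finset.sum_sub_distrib, ← Finset.mul_sum, Finset.sum_sub_distrib, sum_signs_sq,
    ← Finset.sum_div, ← Finset.sum_div, ← Finset.sum_filter, Finset.sum_const, nsmul_eq_mul] at hsum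
  simp only [Finset.sum_const, Finset.card_univ, Fintype.card_fun, Fintype.card_bool,
    Fintype.card_fin, nsmul_eq_mul, Nat.cast_pow, Nat.cast_ofNat] at hsum
  have h4 := sum_signs_fourth_le v
  rw [show l2 v ^ 2 = s from rfl] at h4 hsum
  have : 3 / 16 * (2 : ℝ) ^ n * s ^ 2 ≤
      ((Finset.univ.filter fun σ : Fin n → Bool => s / 4 ≤ (v ⬝ᵥ signVec σ) ^ 2).card : ℝ)
        * s ^ 2 := by
    linarith
  exact le_of_mul_le_mul_right this (by positivity)

end Signs

section Deterministic

variable {d k : ℕ} {κ : Type*} [Fintype κ] {A : Matrix (Fin d) (Fin d) ℝ}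
  {U : Matrix (Fin d) (Fin k) ℝ} {W : Matrix (Fin d) κ ℝ} {lam lamBar : ℝ}

/-- The sign vector `σ` is bad for `S` if the equation `Uᵀ S y = σ` has no solution `y` for which
`S y` has squared norm at most `K`. -/
def BadSign (U S : Matrix (Fin d) (Fin k) ℝ) (K : ℝ) (σ : Fin k → Bool) : Prop :=
  ¬ ∃ y, Uᵀ *ᵥ (S *ᵥ y) = signVec σ ∧ l2 (S *ᵥ y) ^ 2 ≤ K

open Classical in
/-- If few sign vectors are bad then `S (Uᵀ S)⁻¹` has operator norm at most `2 √K`, since its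
transpose applied to any vector is tested by some sign vector which is not bad. -/
lemma tanLE_of_card_badSign_lt (h : SpectralSplit A U W lam lamBar)
    {S : Matrix (Fin d) (Fin k) ℝ} {K : ℝ} (hK : 0 ≤ K)
    (hcard : ((Finset.univ.filter (BadSign U S K)).card : ℝ) < 3 / 16 * 2 ^ k) :
    TanLE U W S (Real.sqrt (4 * K)) := by
  set M : Matrix (Fin k) (Fin k) ℝ := Uᵀ * S with hM
  have htest : ∀ v : Fin k → ℝ, v ≠ 0 → ∃ y, l2 v ^ 2 / 4 ≤ (v ⬝ᵥ (M *ᵥ y)) ^ 2 ∧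
      l2 (S *ᵥ y) ^ 2 ≤ K := by
    intro v hv
    have h1 := hcard.trans_le (card_signs_ge v hv)
    have h2 : (Finset.univ.filter (BadSign U S K)).card <
        (Finset.univ.filter fun σ : Fin k → Bool => l2 v ^ 2 / 4 ≤ (v ⬝ᵥ signVec σ) ^ 2).card := by
      exact_mod_cast h1
    obtain ⟨σ, hσ1, hσ2⟩ := Finset.exists_mem_notMem_of_card_lt_card h2
    simp only [Finset.mem_filter, Finset.mem_univ, true_and] at hσ1 hσ2
    obtain ⟨y, hy1, hy2⟩ := not_not.1 hσ2
    refine ⟨y, ?_, hy2⟩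
    rwa [hM, ← mulVec_mulVec, hy1]
  have hdet : M.det ≠ 0 := by
    intro h0
    obtain ⟨v, hv, hvM⟩ := exists_vecMul_eq_zero_iff.2 h0
    obtain ⟨y, hy, -⟩ := htest v hv
    rw [dotProduct_mulVec, hvM, zero_dotProduct] at hy
    have := pow_pos (l2_pos hv) 2
    linarith
  have hunit : IsUnit M.det := isUnit_iff_ne_zero.2 hdet
  have hbound : ∀ w, l2 (S *ᵥ w) ^ 2 ≤ 4 * K * l2 (M *ᵥ w) ^ 2 := by
    intro w
    set q := S *ᵥ w with hq
    set v := (q ᵥ* S) ᵥ* M⁻¹ with hv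
    have hvM : ∀ y, v ⬝ᵥ (M *ᵥ y) = q ⬝ᵥ (S *ᵥ y) := by
      intro y
      rw [hv, dotProduct_mulVec, vecMul_vecMul, nonsing_inv_mul _ hunit, vecMul_one,
        ← dotProduct_mulVec]
    have hvq : l2 v ^ 2 ≤ 4 * K * l2 q ^ 2 := by
      rcases eq_or_ne v 0 with h0 | h0
      · rw [h0, l2_zero]
        have := sq_nonneg (l2 q)
        nlinarith
      · obtain ⟨y, hy1, hy2⟩ := htest v h0
        rw [hvM] at hy1
        have h3 := dotProduct_sq_le q (S *ᵥ y)
        have h4 := mul_le_mul_of_nonneg_left hy2 (sq_nonneg (l2 q))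
        linarith
    rcases eq_or_ne q 0 with h0 | h0
    · rw [h0, l2_zero]
      have := sq_nonneg (l2 (M *ᵥ w))
      nlinarith
    · have h1 : (l2 q ^ 2) ^ 2 ≤ l2 v ^ 2 * l2 (M *ᵥ w) ^ 2 := by
        have := dotProduct_sq_le v (M *ᵥ w)
        rwa [hvM, ← hq, ← l2_sq_eq_dotProduct] at this
      have h2 : l2 v ^ 2 * l2 (M *ᵥ w) ^ 2 ≤ 4 * K * l2 q ^ 2 * l2 (M *ᵥ w) ^ 2 :=
        mul_le_mul_of_nonneg_right hvq (sq_nonneg _)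
      have h3 : 0 < l2 q ^ 2 := pow_pos (l2_pos h0) 2
      refine le_of_mul_le_mul_left ?_ h3
      linarith
  constructor
  · intro w hw
    rw [mulVec_mulVec] at hw
    by_contra hne
    exact hdet (exists_mulVec_eq_zero_iff.1 ⟨w, hne, hw⟩)
  · intro w
    refine (h.tail_le_norm _).trans ?_
    apply le_of_sq_le_sq _ (mul_nonneg (Real.sqrt_nonneg _) (l2_nonneg _))
    rw [mul_pow, Real.sq_sqrt (by positivity), mulVec_mulVec]
    exact hbound w

end Deterministic

/-! ### The angle of a Gaussian matrix -/

section GaussianFamily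

variable {ι Ω : Type*} [Fintype ι] [MeasurableSpace Ω] {P : Measure Ω} {G : ι → Ω → ℝ}

lemma hasGaussianLaw_family (hG : ∀ i, HasLaw (G i) (gaussianReal 0 1) P) (hind : iIndepFun G P) :
    HasGaussianLaw (fun ω i => G i ω) P :=
  hind.hasGaussianLaw fun i => (hG i).hasGaussianLaw

lemma integral_gaussian_comb (hG : ∀ i, HasLaw (G i) (gaussianReal 0 1) P) (c : ι → ℝ) :
    ∫ ω, ∑ i, c i * G i ω ∂P = 0 := by
  rw [integral_finsetSum _ fun i _ => ((hG i).hasGaussianLaw.integrable).const_mul _]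
  refine Finset.sum_eq_zero fun i _ => ?_
  rw [integral_const_mul, (hG i).integral_eq, integral_id_gaussianReal, mul_zero]

lemma hasGaussianLaw_comb (hG : ∀ i, HasLaw (G i) (gaussianReal 0 1) P) (hind : iIndepFun G P)
    (c : ι → ℝ) : HasGaussianLaw (fun ω => ∑ i, c i * G i ω) P := by
  have h := (hasGaussianLaw_family hG hind).map_fun
    (∑ i, c i • ContinuousLinearMap.proj (R := ℝ) (φ := fun _ : ι => ℝ) i)
  simpa using h

variable [IsProbabilityMeasure P]

lemma covariance_gaussian_comb (hG : ∀ i, HasLaw (G i) (gaussianReal 0 1) P)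
    (hind : iIndepFun G P) (c c' : ι → ℝ) :
    cov[fun ω => ∑ i, c i * G i ω, fun ω => ∑ i, c' i * G i ω; P] = ∑ i, c i * c' i := by
  classical
  have hL : ∀ i, MemLp (G i) 2 P := fun i => (hG i).hasGaussianLaw.memLp_two
  rw [covariance_fun_sum_fun_sum (fun i => (hL i).const_mul _) (fun i => (hL i).const_mul _)]
  refine Finset.sum_congr rfl fun i _ => ?_
  rw [Finset.sum_eq_single i]
  · rw [covariance_const_mul_left, covariance_const_mul_right,
      covariance_self (hL i).1.aemeasurable,
      (hG i).variance_eq, variance_id_gaussianReal]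
    simp
  · intro j _ hj
    rw [covariance_const_mul_left, covariance_const_mul_right,
      (hind.indepFun hj.symm).covariance_eq_zero (hL i) (hL j)]
    simp
  · simp

lemma integral_gaussian_comb_sq (hG : ∀ i, HasLaw (G i) (gaussianReal 0 1) P)
    (hind : iIndepFun G P) (c : ι → ℝ) :
    ∫ ω, (∑ i, c i * G i ω) ^ 2 ∂P = ∑ i, c i ^ 2 := by
  have hm := (hasGaussianLaw_comb hG hind c).aemeasurable
  rw [← variance_of_integral_eq_zero hm (integral_gaussian_comb hG c), ← covariance_self hm,
    covariance_gaussian_comb hG hind]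
  simp [sq]

lemma hasLaw_gaussian_comb (hG : ∀ i, HasLaw (G i) (gaussianReal 0 1) P) (hind : iIndepFun G P)
    {c : ι → ℝ} (hc : ∑ i, c i ^ 2 = 1) :
    HasLaw (fun ω => ∑ i, c i * G i ω) (gaussianReal 0 1) P := by
  have h := hasGaussianLaw_comb hG hind c
  refine ⟨h.aemeasurable, ?_⟩
  rw [h.map_eq_gaussianReal, integral_gaussian_comb hG c, ← covariance_self h.aemeasurable,
    covariance_gaussian_comb hG hind]
  simp_rw [← sq, hc, Real.toNNReal_one]

/-- Linear images of a standard Gaussian family with orthogonal coefficient vectors are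
independent. -/
lemma indepFun_gaussian_comb {α β : Type*} [Fintype α] [Fintype β]
    (hG : ∀ i, HasLaw (G i) (gaussianReal 0 1) P) (hind : iIndepFun G P)
    (c : α → ι → ℝ) (c' : β → ι → ℝ) (horth : ∀ a b, ∑ i, c a i * c' b i = 0) :
    IndepFun (fun ω a => ∑ i, c a i * G i ω) (fun ω b => ∑ i, c' b i * G i ω) P := by
  apply HasGaussianLaw.indepFun_of_covariance_eval (X := fun a ω => ∑ i, c a i * G i ω)
    (Y := fun b ω => ∑ i, c' b i * G i ω)
  · have h := (hasGaussianLaw_family hG hind).map_fun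
      ((ContinuousLinearMap.pi fun a : α =>
          ∑ i, c a i • ContinuousLinearMap.proj (R := ℝ) (φ := fun _ : ι => ℝ) i).prod
        (ContinuousLinearMap.pi fun b : β =>
          ∑ i, c' b i • ContinuousLinearMap.proj (R := ℝ) (φ := fun _ : ι => ℝ) i))
    refine (congrArg (fun f => HasGaussianLaw f P) ?_).mp h
    funext ω
    ext <;> simp
  · intro a b
    rw [covariance_gaussian_comb hG hind, horth]

lemma gaussianReal_abs_lt_le (τ : ℝ) :
    gaussianReal 0 1 {x | |x| < τ} ≤ ENNReal.ofReal τ := by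
  have hpdf : ∀ x, gaussianPDF 0 1 x ≤ ENNReal.ofReal (1 / 2) := by
    intro x
    refine ENNReal.ofReal_le_ofReal ?_
    have h1 : (2 : ℝ) ≤ Real.sqrt (2 * Real.pi * (1 : NNReal)) := by
      apply Real.le_sqrt_of_sq_le
      have := Real.pi_gt_three
      simp only [NNReal.coe_one]
      linarith
    have h2 : (Real.sqrt (2 * Real.pi * (1 : NNReal)))⁻¹ ≤ 1 / 2 := by
      rw [one_div]; exact inv_anti₀ (by norm_num) h1
    have h3 : Real.exp (-(x - 0) ^ 2 / (2 * (1 : NNReal))) ≤ 1 := by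
      apply Real.exp_le_one_iff.2
      apply div_nonpos_of_nonpos_of_nonneg
      · linarith [sq_nonneg (x - 0)]
      · positivity
    calc gaussianPDFReal 0 1 x ≤ 1 / 2 * 1 := by
          unfold gaussianPDFReal
          exact mul_le_mul h2 h3 (Real.exp_pos _).le (by norm_num)
      _ = 1 / 2 := mul_one _
  have hset : {x : ℝ | |x| < τ} = Set.Ioo (-τ) τ := by ext x; exact abs_lt (a := x)
  rw [gaussianReal_of_var_ne_zero 0 one_ne_zero, hset, withDensity_apply _ measurableSet_Ioo]
  calc ∫⁻ x in Set.Ioo (-τ) τ, gaussianPDF 0 1 x ≤ ∫⁻ x in Set.Ioo (-τ) τ, ENNReal.ofReal (1 / 2) :=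
        lintegral_mono hpdf
    _ = ENNReal.ofReal τ := by
        rw [setLIntegral_const, Real.volume_Ioo, ← ENNReal.ofReal_mul (by norm_num)]
        congr 1
        ring

end GaussianFamily

section Measurability

variable {m n l : ℕ}

lemma continuous_l2 {ι : Type*} [Fintype ι] : Continuous (l2 : (ι → ℝ) → ℝ) := by
  unfold l2
  fun_prop

/-- The set of pairs `(z, Y)` for which the linear equations `z y = 0`, `u ⬝ Y y = 1` have a
solution `y` with `Y y` of squared norm at most `K`. -/
def solvableSet (m l : ℕ) {n : ℕ} (u : Fin n → ℝ) (K : ℝ) :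
    Set ((Fin m × Fin l → ℝ) × (Fin n × Fin l → ℝ)) :=
  {p | ∃ y : Fin l → ℝ, (Matrix.of fun i j => p.1 (i, j)) *ᵥ y = 0 ∧
    u ⬝ᵥ ((Matrix.of fun i j => p.2 (i, j)) *ᵥ y) = 1 ∧
    l2 ((Matrix.of fun i j => p.2 (i, j)) *ᵥ y) ^ 2 ≤ K}

/-- The set is a countable union of closed sets, each the projection of a closed set along a compact
ball of solutions `y`. -/
lemma measurableSet_solvableSet (u : Fin n → ℝ) (K : ℝ) :
    MeasurableSet (solvableSet m l u K) := by
  have hclosed : ∀ r : ℕ, IsClosed (Prod.snd ''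
      {q : (Metric.closedBall (0 : Fin l → ℝ) r) ×
          ((Fin m × Fin l → ℝ) × (Fin n × Fin l → ℝ)) |
        (Matrix.of fun i j => q.2.1 (i, j)) *ᵥ (q.1 : Fin l → ℝ) = 0 ∧
        u ⬝ᵥ ((Matrix.of fun i j => q.2.2 (i, j)) *ᵥ (q.1 : Fin l → ℝ)) = 1 ∧
        l2 ((Matrix.of fun i j => q.2.2 (i, j)) *ᵥ (q.1 : Fin l → ℝ)) ^ 2 ≤ K}) := by
    intro r
    have : CompactSpace (Metric.closedBall (0 : Fin l → ℝ) r) :=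
      isCompact_iff_compactSpace.1 (isCompact_closedBall _ _)
    apply isClosedMap_snd_of_compactSpace
    have h1 : Continuous fun q : (Metric.closedBall (0 : Fin l → ℝ) r) ×
        ((Fin m × Fin l → ℝ) × (Fin n × Fin l → ℝ)) =>
        (Matrix.of fun i j => q.2.1 (i, j)) *ᵥ (q.1 : Fin l → ℝ) := by
      apply Continuous.matrix_mulVec _ (continuous_subtype_val.comp continuous_fst)
      exact continuous_matrix fun i j => by simp only [of_apply]; fun_prop
    have h2 : Continuous fun q : (Metric.closedBall (0 : Fin l → ℝ) r) ×
        ((Fin m × Fin l → ℝ) × (Fin n × Fin l → ℝ)) =>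
        (Matrix.of fun i j => q.2.2 (i, j)) *ᵥ (q.1 : Fin l → ℝ) := by
      apply Continuous.matrix_mulVec _ (continuous_subtype_val.comp continuous_fst)
      exact continuous_matrix fun i j => by simp only [of_apply]; fun_prop
    refine (isClosed_eq h1 continuous_const).inter ((isClosed_eq ?_ continuous_const).inter
      (isClosed_le ((continuous_l2.comp h2).pow 2) continuous_const))
    exact continuous_const.dotProduct h2
  have heq : solvableSet m l u K = ⋃ r : ℕ, (Prod.snd ''
      {q : (Metric.closedBall (0 : Fin l → ℝ) r) ×
          ((Fin m × Fin l → ℝ) × (Fin n × Fin l → ℝ)) |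
        (Matrix.of fun i j => q.2.1 (i, j)) *ᵥ (q.1 : Fin l → ℝ) = 0 ∧
        u ⬝ᵥ ((Matrix.of fun i j => q.2.2 (i, j)) *ᵥ (q.1 : Fin l → ℝ)) = 1 ∧
        l2 ((Matrix.of fun i j => q.2.2 (i, j)) *ᵥ (q.1 : Fin l → ℝ)) ^ 2 ≤ K}) := by
    ext p
    simp only [Set.mem_iUnion, Set.mem_image]
    constructor
    · rintro ⟨y, hy⟩
      obtain ⟨r, hr⟩ := exists_nat_ge ‖y‖
      exact ⟨r, (⟨y, by simpa using hr⟩, p), hy, rfl⟩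
    · rintro ⟨r, q, hq, rfl⟩
      exact ⟨q.1, hq⟩
  rw [heq]
  exact MeasurableSet.iUnion fun r => (hclosed r).measurableSet

end Measurability

section GaussianMatrix

variable {d k : ℕ} {Ω : Type*} [MeasurableSpace Ω] {P : Measure Ω} [IsProbabilityMeasure P]
  {S : Ω → Matrix (Fin d) (Fin k) ℝ}

lemma dotProduct_mulVec_eq_sum (S : Matrix (Fin d) (Fin k) ℝ) (q : Fin d → ℝ) (y : Fin k → ℝ) :
    q ⬝ᵥ (S *ᵥ y) = ∑ p : Fin d × Fin k, (q p.1 * y p.2) * S p.1 p.2 := by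
  rw [Fintype.sum_prod_type, dotProduct]
  refine Finset.sum_congr rfl fun i _ => ?_
  rw [mulVec, dotProduct, Finset.mul_sum]
  exact Finset.sum_congr rfl fun j _ => by ring

lemma sum_mul_sq_eq_one {q : Fin d → ℝ} {y : Fin k → ℝ} (hq : l2 q ^ 2 = 1) (hy : l2 y ^ 2 = 1) :
    ∑ p : Fin d × Fin k, (q p.1 * y p.2) ^ 2 = 1 := by
  rw [Fintype.sum_prod_type]
  simp_rw [mul_pow, ← Finset.mul_sum]
  rw [← Finset.sum_mul, ← l2_sq, ← l2_sq, hq, hy, one_mul]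

lemma measure_abs_dotProduct_lt_le (hS : ∀ i j, HasLaw (fun ω => S ω i j) (gaussianReal 0 1) P)
    (hind : iIndepFun (fun (p : Fin d × Fin k) ω => S ω p.1 p.2) P) {q : Fin d → ℝ} {y : Fin k → ℝ}
    (hq : l2 q ^ 2 = 1) (hy : l2 y ^ 2 = 1) (τ : ℝ) :
    P {ω | |q ⬝ᵥ (S ω *ᵥ y)| < τ} ≤ ENNReal.ofReal τ := by
  have h := hasLaw_gaussian_comb (G := fun (p : Fin d × Fin k) ω => S ω p.1 p.2)
    (fun p => hS p.1 p.2) hind (c := fun p => q p.1 * y p.2) (sum_mul_sq_eq_one hq hy)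
  simp_rw [dotProduct_mulVec_eq_sum]
  rw [h.measure_eq (p := fun x => |x| < τ) (measurableSet_lt measurable_norm measurable_const)]
  exact gaussianReal_abs_lt_le τ

lemma measure_lt_l2_mulVec_sq_le (hS : ∀ i j, HasLaw (fun ω => S ω i j) (gaussianReal 0 1) P)
    (hind : iIndepFun (fun (p : Fin d × Fin k) ω => S ω p.1 p.2) P) {y : Fin k → ℝ}
    (hy : l2 y ^ 2 = 1) {r : ℝ} (hr : 0 < r) :
    P {ω | r < l2 (S ω *ᵥ y) ^ 2} ≤ ENNReal.ofReal (d / r) := by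
  have hcoord : ∀ i ω, (S ω *ᵥ y) i =
      ∑ p : Fin d × Fin k, ((Pi.single i 1 : Fin d → ℝ) p.1 * y p.2) * S ω p.1 p.2 := by
    intro i ω
    rw [← dotProduct_mulVec_eq_sum, single_one_dotProduct]
  have hsq : ∀ i, ∫ ω, (S ω *ᵥ y) i ^ 2 ∂P = 1 := by
    intro i
    simp_rw [hcoord]
    rw [integral_gaussian_comb_sq (G := fun (p : Fin d × Fin k) ω => S ω p.1 p.2)
      (fun p => hS p.1 p.2) hind]
    apply sum_mul_sq_eq_one _ hy
    rw [l2_sq_eq_dotProduct, single_one_dotProduct, Pi.single_eq_same]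
  have hint : ∀ i, Integrable (fun ω => (S ω *ᵥ y) i ^ 2) P := by
    intro i
    simp_rw [hcoord]
    exact (hasGaussianLaw_comb (G := fun (p : Fin d × Fin k) ω => S ω p.1 p.2)
      (fun p => hS p.1 p.2) hind _).memLp_two.integrable_sq
  have hE : ∫ ω, l2 (S ω *ᵥ y) ^ 2 ∂P = d := by
    simp_rw [l2_sq]
    rw [integral_finsetSum _ fun i _ => hint i]
    simp [hsq]
  have hI : Integrable (fun ω => l2 (S ω *ᵥ y) ^ 2) P := by
    simp_rw [l2_sq]
    exact integrable_finsetSum _ fun i _ => hint i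
  have hmk := mul_meas_ge_le_integral_of_nonneg (μ := P)
    (Filter.Eventually.of_forall fun ω => sq_nonneg (l2 (S ω *ᵥ y))) hI r
  rw [hE] at hmk
  refine (ENNReal.le_ofReal_iff_toReal_le (measure_ne_top _ _) (by positivity)).2 ?_
  rw [le_div_iff₀ hr, mul_comm]
  refine le_trans (mul_le_mul_of_nonneg_left ?_ hr.le) hmk
  exact measureReal_mono (fun ω (hω : r < _) => hω.le) (measure_ne_top _ _)

/-- For a fixed unit vector `a` of length `k`, a Gaussian matrix `S` and an orthonormal frame `U`,
the equation `Uᵀ S y = a` has a solution `y` with `‖S y‖² ≤ K d` with large probability. Up to a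
scalar, `y` is a unit vector in the kernel of `(1 - a aᵀ) Uᵀ S`, which is independent of the
complementary part of `S`; so this unit vector can be treated as fixed, and the scalar is the
inverse of a standard normal variable. -/
lemma measure_not_solvable_le (hS : ∀ i j, HasLaw (fun ω => S ω i j) (gaussianReal 0 1) P)
    (hind : iIndepFun (fun (p : Fin d × Fin k) ω => S ω p.1 p.2) P) (hd : 0 < d)
    {U : Matrix (Fin d) (Fin k) ℝ} (hU : Uᵀ * U = 1) {a : Fin k → ℝ} (ha : l2 a ^ 2 = 1)
    {K τ : ℝ} (hK : 0 < K) (hτ : 0 < τ) :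
    P {ω | ¬ ∃ y, Uᵀ *ᵥ (S ω *ᵥ y) = a ∧ l2 (S ω *ᵥ y) ^ 2 ≤ K * d} ≤
      ENNReal.ofReal τ + ENNReal.ofReal (1 / (K * τ ^ 2)) := by
  have hd' : (0 : ℝ) < d := by exact_mod_cast hd
  have haa : a ⬝ᵥ a = 1 := by rw [← l2_sq_eq_dotProduct, ha]
  set N : Matrix (Fin k) (Fin k) ℝ := 1 - vecMulVec a a with hN
  have hNv : ∀ v, N *ᵥ v = v - (a ⬝ᵥ v) • a := by
    intro v
    rw [hN, sub_mulVec, one_mulVec, vecMulVec_mulVec]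
    simp
  have hNT : Nᵀ = N := by
    rw [hN, transpose_sub, transpose_one, transpose_vecMulVec]
  have hNN : N * N = N := by
    have h1 : vecMulVec a a * vecMulVec a a = vecMulVec a a := by
      rw [vecMulVec_mul_vecMulVec, haa, one_smul]
    rw [hN, Matrix.sub_mul, Matrix.mul_sub, Matrix.mul_sub, h1]
    simp
  have hNa : N *ᵥ a = 0 := by rw [hNv, haa, one_smul, sub_self]
  set B₂ : Matrix (Fin k) (Fin d) ℝ := N * Uᵀ with hB₂
  set B₁ : Matrix (Fin d) (Fin d) ℝ := 1 - U * B₂ with hB₁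
  have hB₂T : B₂ᵀ = U * N := by rw [hB₂, transpose_mul, transpose_transpose, hNT]
  have hB₁T : B₁ᵀ = B₁ := by
    rw [hB₁, transpose_sub, transpose_one, transpose_mul, hB₂T, hB₂, Matrix.mul_assoc]
  have horth : B₁ * B₂ᵀ = 0 := by
    rw [hB₂T, hB₁, Matrix.sub_mul, Matrix.one_mul, hB₂, Matrix.mul_assoc U, Matrix.mul_assoc N,
      ← Matrix.mul_assoc Uᵀ, hU, Matrix.one_mul, hNN, sub_self]
  have hB₁B₁ : B₁ * B₁ = B₁ := by
    have h1 : B₁ * (U * B₂) = 0 := by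
      rw [hB₂, ← Matrix.mul_assoc U, ← hB₂T, ← Matrix.mul_assoc, horth, Matrix.zero_mul]
    conv_lhs => rw [hB₁]
    rw [← hB₁, show B₁ * B₁ = B₁ * (1 - U * B₂) from rfl, Matrix.mul_sub, h1, Matrix.mul_one,
      sub_zero]
  have hB₁le : ∀ v, l2 (B₁ *ᵥ v) ≤ l2 v := by
    intro v
    have h1 : l2 (B₁ *ᵥ v) ^ 2 = v ⬝ᵥ (B₁ *ᵥ v) := by
      rw [l2_sq_eq_dotProduct, dotProduct_mulVec, ← mulVec_transpose, hB₁T, mulVec_mulVec, hB₁B₁,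
        dotProduct_comm]
    have h2 := dotProduct_sq_le v (B₁ *ᵥ v)
    rw [← h1] at h2
    rcases eq_or_ne (l2 (B₁ *ᵥ v)) 0 with h0 | h0
    · rw [h0]; exact l2_nonneg _
    · have h3 : 0 < l2 (B₁ *ᵥ v) ^ 2 := by positivity
      exact le_of_sq_le_sq (le_of_mul_le_mul_right (by linarith) h3) (l2_nonneg _)
  set u : Fin d → ℝ := U *ᵥ a with hu
  have hu1 : l2 u ^ 2 = 1 := by rw [hu, l2_mulVec_of_orthonormal hU, ha]
  have hB₂u : B₂ *ᵥ u = 0 := by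
    rw [hu, hB₂, mulVec_mulVec, Matrix.mul_assoc, hU, Matrix.mul_one, hNa]
  have hB₁u : B₁ *ᵥ u = u := by
    rw [hB₁, sub_mulVec, one_mulVec, ← mulVec_mulVec, hB₂u, mulVec_zero, sub_zero]
  have huB₁ : ∀ v, u ⬝ᵥ (B₁ *ᵥ v) = u ⬝ᵥ v := by
    intro v
    rw [dotProduct_mulVec, ← mulVec_transpose, hB₁T, hB₁u]
  set Z : Ω → (Fin k × Fin k → ℝ) := fun ω p => (B₂ * S ω) p.1 p.2 with hZ
  set Y : Ω → (Fin d × Fin k → ℝ) := fun ω p => (B₁ * S ω) p.1 p.2 with hY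
  have hexp : ∀ {α : Type} [Fintype α] (B : Matrix α (Fin d) ℝ) ω (p : α × Fin k),
      (B * S ω) p.1 p.2 = ∑ q : Fin d × Fin k,
        (B p.1 q.1 * (Pi.single p.2 1 : Fin k → ℝ) q.2) * S ω q.1 q.2 := by
    intro α _ B ω p
    rw [← dotProduct_mulVec_eq_sum, mulVec_single_one]
    rfl
  have hZY : IndepFun Z Y P := by
    have := indepFun_gaussian_comb (G := fun (p : Fin d × Fin k) ω => S ω p.1 p.2)
      (fun p => hS p.1 p.2) hind
      (fun (p : Fin k × Fin k) q => B₂ p.1 q.1 * (Pi.single p.2 1 : Fin k → ℝ) q.2)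
      (fun (p : Fin d × Fin k) q => B₁ p.1 q.1 * (Pi.single p.2 1 : Fin k → ℝ) q.2) (by
        intro p p'
        have h1 : ∑ i, B₂ p.1 i * B₁ p'.1 i = 0 := by
          have h2 := congrFun (congrFun horth p'.1) p.1
          rw [mul_apply] at h2
          exact (Finset.sum_congr rfl fun i _ => mul_comm _ _).trans h2
        rw [Fintype.sum_prod_type, Finset.sum_comm]
        refine Finset.sum_eq_zero fun j _ => ?_
        calc _ = (∑ i, B₂ p.1 i * B₁ p'.1 i) * ((Pi.single p.2 1 : Fin k → ℝ) j *
              (Pi.single p'.2 1 : Fin k → ℝ) j) := by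
              rw [Finset.sum_mul]
              exact Finset.sum_congr rfl fun i _ => by ring
          _ = 0 := by rw [h1, zero_mul])
    simp_rw [← hexp] at this
    exact this
  have hmeas : ∀ {α : Type} [Fintype α] (B : Matrix α (Fin d) ℝ),
      AEMeasurable (fun ω (p : α × Fin k) => (B * S ω) p.1 p.2) P := by
    intro α _ B
    refine aemeasurable_pi_lambda _ fun p => ?_
    simp_rw [hexp]
    exact Finset.aemeasurable_fun_sum _ fun q _ => (hS q.1 q.2).aemeasurable.const_mul _
  have hZm : AEMeasurable Z P := hmeas B₂
  have hYm : AEMeasurable Y P := hmeas B₁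
  have hDm := measurableSet_solvableSet (m := k) (l := k) u (K * d)
  have hsub : {ω | ¬ ∃ y, Uᵀ *ᵥ (S ω *ᵥ y) = a ∧ l2 (S ω *ᵥ y) ^ 2 ≤ K * d} ⊆
      (fun ω => (Z ω, Y ω)) ⁻¹' (solvableSet k k u (K * d))ᶜ := by
    intro ω hω hmem
    apply hω
    obtain ⟨y, hy1, hy2, hy3⟩ := hmem
    have h1 : (B₂ * S ω) *ᵥ y = 0 := hy1
    have h2 : (B₁ * S ω) *ᵥ y = S ω *ᵥ y := by
      rw [hB₁, Matrix.sub_mul, Matrix.one_mul, sub_mulVec, Matrix.mul_assoc, ← mulVec_mulVec _ U,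
        h1, mulVec_zero, sub_zero]
    have h3 : u ⬝ᵥ ((B₁ * S ω) *ᵥ y) = 1 := hy2
    have h4 : l2 ((B₁ * S ω) *ᵥ y) ^ 2 ≤ K * d := hy3
    rw [h2] at h3 h4
    refine ⟨y, ?_, h4⟩
    rw [hB₂, ← mulVec_mulVec, ← mulVec_mulVec, hNv] at h1
    have h5 : a ⬝ᵥ (Uᵀ *ᵥ (S ω *ᵥ y)) = 1 := by
      rw [dotProduct_mulVec, vecMul_transpose]; exact h3
    rw [h5, one_smul, sub_eq_zero] at h1
    exact h1
  -- on the slice over `z`, a fixed unit vector in the kernel of `z` provides the solution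
  have hslice : ∀ z : Fin k × Fin k → ℝ, a ᵥ* (Matrix.of fun i j => z (i, j)) = 0 →
      (P.map Y) (Prod.mk z ⁻¹' (solvableSet k k u (K * d))ᶜ) ≤
        ENNReal.ofReal τ + ENNReal.ofReal (1 / (K * τ ^ 2)) := by
    intro z hz
    have ha0 : a ≠ 0 := by
      rintro rfl
      rw [l2_zero] at ha
      norm_num at ha
    have hdet := exists_vecMul_eq_zero_iff.1 ⟨a, ha0, hz⟩
    obtain ⟨y', hy'0, hy'⟩ := exists_mulVec_eq_zero_iff.2 hdet
    have hlpos := l2_pos hy'0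
    set y := (l2 y')⁻¹ • y' with hy
    have hy1 : l2 y ^ 2 = 1 := by
      rw [hy, l2_smul, abs_of_pos (inv_pos.2 hlpos), inv_mul_cancel₀ hlpos.ne', one_pow]
    have hzy : (Matrix.of fun i j => z (i, j)) *ᵥ y = 0 := by rw [hy, mulVec_smul, hy', smul_zero]
    have hms : MeasurableSet (Prod.mk z ⁻¹' (solvableSet k k u (K * d))ᶜ) :=
      measurable_prodMk_left hDm.compl
    rw [Measure.map_apply_of_aemeasurable hYm hms]
    have hsub2 : Y ⁻¹' (Prod.mk z ⁻¹' (solvableSet k k u (K * d))ᶜ) ⊆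
        {ω | |u ⬝ᵥ (S ω *ᵥ y)| < τ} ∪ {ω | K * d * τ ^ 2 < l2 (S ω *ᵥ y) ^ 2} := by
      intro ω hω
      by_contra hcon
      simp only [Set.mem_union, Set.mem_ofPred_eq, not_or, not_lt] at hcon
      obtain ⟨hc1, hc2⟩ := hcon
      apply hω
      set b := u ⬝ᵥ (S ω *ᵥ y) with hb
      have hb0 : b ≠ 0 := by
        intro h0
        rw [h0, abs_zero] at hc1
        linarith
      have hYy : (Matrix.of fun i j => Y ω (i, j)) *ᵥ y = B₁ *ᵥ (S ω *ᵥ y) :=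
        (mulVec_mulVec y B₁ (S ω)).symm
      refine ⟨b⁻¹ • y, ?_, ?_, ?_⟩
      · change (Matrix.of fun i j => z (i, j)) *ᵥ (b⁻¹ • y) = 0
        rw [mulVec_smul, hzy, smul_zero]
      · change u ⬝ᵥ ((Matrix.of fun i j => Y ω (i, j)) *ᵥ (b⁻¹ • y)) = 1
        rw [mulVec_smul, hYy, dotProduct_smul, huB₁, ← hb, smul_eq_mul, inv_mul_cancel₀ hb0]
      · change l2 ((Matrix.of fun i j => Y ω (i, j)) *ᵥ (b⁻¹ • y)) ^ 2 ≤ K * d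
        have hb2 : τ ^ 2 ≤ b ^ 2 := by
          rw [← sq_abs b]
          exact pow_le_pow_left₀ hτ.le hc1 2
        rw [mulVec_smul, hYy, l2_smul, mul_pow, sq_abs, inv_pow, inv_mul_le_iff₀ (by positivity)]
        calc l2 (B₁ *ᵥ (S ω *ᵥ y)) ^ 2 ≤ l2 (S ω *ᵥ y) ^ 2 :=
              pow_le_pow_left₀ (l2_nonneg _) (hB₁le _) 2
          _ ≤ K * d * τ ^ 2 := hc2
          _ ≤ K * d * b ^ 2 := mul_le_mul_of_nonneg_left hb2 (by positivity)
          _ = b ^ 2 * (K * d) := mul_comm _ _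
    refine (measure_mono hsub2).trans ((measure_union_le _ _).trans (add_le_add ?_ ?_))
    · exact measure_abs_dotProduct_lt_le hS hind hu1 hy1 τ
    · refine (measure_lt_l2_mulVec_sq_le hS hind hy1 (by positivity)).trans (le_of_eq ?_)
      congr 1
      field_simp
  have hZa : ∀ᵐ z ∂(P.map Z), a ᵥ* (Matrix.of fun i j => z (i, j)) = 0 := by
    have hcl : MeasurableSet
        {z : Fin k × Fin k → ℝ | a ᵥ* (Matrix.of fun i j => z (i, j)) = 0} := by
      apply IsClosed.measurableSet
      apply isClosed_eq _ continuous_const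
      apply Continuous.matrix_vecMul continuous_const
      exact continuous_matrix fun i j => by simp only [of_apply]; fun_prop
    rw [ae_map_iff hZm hcl]
    refine Filter.Eventually.of_forall fun ω => ?_
    change a ᵥ* (B₂ * S ω) = 0
    rw [hB₂, Matrix.mul_assoc, ← vecMul_vecMul, ← mulVec_transpose N, hNT, hNa, zero_vecMul]
  have hprod := (indepFun_iff_map_prod_eq_prod_map_map hZm hYm).1 hZY
  have : IsProbabilityMeasure (P.map Z) := Measure.isProbabilityMeasure_map hZm
  have : IsProbabilityMeasure (P.map Y) := Measure.isProbabilityMeasure_map hYm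
  calc P {ω | ¬ ∃ y, Uᵀ *ᵥ (S ω *ᵥ y) = a ∧ l2 (S ω *ᵥ y) ^ 2 ≤ K * d}
      ≤ P ((fun ω => (Z ω, Y ω)) ⁻¹' (solvableSet k k u (K * d))ᶜ) := measure_mono hsub
    _ = ((P.map Z).prod (P.map Y)) (solvableSet k k u (K * d))ᶜ := by
        rw [← hprod, Measure.map_apply_of_aemeasurable (hZm.prodMk hYm) hDm.compl]
    _ = ∫⁻ z, (P.map Y) (Prod.mk z ⁻¹' (solvableSet k k u (K * d))ᶜ) ∂(P.map Z) :=
        Measure.prod_apply hDm.compl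
    _ ≤ ∫⁻ _, (ENNReal.ofReal τ + ENNReal.ofReal (1 / (K * τ ^ 2))) ∂(P.map Z) :=
        lintegral_mono_ae (hZa.mono hslice)
    _ = _ := by rw [lintegral_const, measure_univ, mul_one]

/-- If every point of `B` lies in at least `c` of the finitely many sets `E i`, then
`c P(B) ≤ ∑ P(E i)`. -/
lemma mul_measure_le_sum_measure {ι Ω : Type*} [Fintype ι] [MeasurableSpace Ω] (P : Measure Ω)
    (B : Set Ω) (E : ι → Set Ω) (c : ℝ)
    (hB : ∀ ω ∈ B, c ≤ ∑ i, (E i).indicator (fun _ => (1 : ℝ)) ω) :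
    ENNReal.ofReal c * P B ≤ ∑ i, P (E i) := by
  set f : Ω → ENNReal := fun ω => ∑ i, (toMeasurable P (E i)).indicator (fun _ => 1) ω with hf
  have hfm : Measurable f := Finset.measurable_fun_sum _ fun i _ =>
    measurable_const.indicator (measurableSet_toMeasurable P (E i))
  have hint : ∫⁻ ω, f ω ∂P = ∑ i, P (E i) := by
    rw [hf, lintegral_finsetSum _ fun i _ =>
      measurable_const.indicator (measurableSet_toMeasurable P (E i))]
    refine Finset.sum_congr rfl fun i _ => ?_
    rw [lintegral_indicator (measurableSet_toMeasurable P (E i)), setLIntegral_const, one_mul,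
      measure_toMeasurable]
  rw [← hint]
  refine le_trans ?_ (mul_meas_ge_le_lintegral hfm (ENNReal.ofReal c))
  refine mul_le_mul_right (measure_mono fun ω hω => ?_) _
  refine (ENNReal.ofReal_le_ofReal (hB ω hω)).trans ?_
  rw [ENNReal.ofReal_sum_of_nonneg fun i _ => Set.indicator_nonneg (fun _ _ => zero_le_one) _]
  refine Finset.sum_le_sum fun i _ => ?_
  by_cases h : ω ∈ E i
  · rw [Set.indicator_of_mem h, Set.indicator_of_mem (subset_toMeasurable P _ h),
      ENNReal.ofReal_one]
  · rw [Set.indicator_of_notMem h, ENNReal.ofReal_zero]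
    exact zero_le

/-- The tangent of the angle between a Gaussian `d × k` matrix and a fixed `k`-dimensional space is
of order at most `√(d k)`, with probability as close to one as desired. -/
lemma measure_not_tanLE_gaussian_le (hS : ∀ i j, HasLaw (fun ω => S ω i j) (gaussianReal 0 1) P)
    (hind : iIndepFun (fun (p : Fin d × Fin k) ω => S ω p.1 p.2) P) (hd : 0 < d) (hk : 0 < k)
    {κ : Type*} [Fintype κ] {A : Matrix (Fin d) (Fin d) ℝ} {U : Matrix (Fin d) (Fin k) ℝ}
    {W : Matrix (Fin d) κ ℝ} {lam lamBar : ℝ} (h : SpectralSplit A U W lam lamBar)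
    (hU : Uᵀ * U = 1) {δ : ℝ} (hδ : 0 < δ) :
    P {ω | ¬ TanLE U W (S ω) (Real.sqrt (4 * (k * (1 / (3 * δ / 32) ^ 3 * d))))} ≤
      ENNReal.ofReal δ := by
  classical
  -- each sign vector is bad with probability at most `τ + 1 / (K τ²) = 2 τ`, and by Markov's
  -- inequality a proportion `3 / 16` of them is bad with probability at most `2 τ / (3 / 16) = δ`
  set τ : ℝ := 3 * δ / 32 with hτ
  have hτ0 : 0 < τ := by positivity
  have hk' : (0 : ℝ) < k := by exact_mod_cast hk
  set K : ℝ := 1 / τ ^ 3 with hK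
  have hK0 : 0 < K := by positivity
  set E : (Fin k → Bool) → Set Ω := fun σ => {ω | BadSign U (S ω) (k * (K * d)) σ} with hE
  have hPE : ∀ σ, P (E σ) ≤ ENNReal.ofReal (2 * τ) := by
    intro σ
    set a : Fin k → ℝ := (Real.sqrt k)⁻¹ • signVec σ with ha
    have hsq : 0 < Real.sqrt k := Real.sqrt_pos.2 hk'
    have ha1 : l2 a ^ 2 = 1 := by
      have h1 : l2 (signVec σ) ^ 2 = k := by
        rw [l2_sq]; simp [signVec_sq]
      rw [ha, l2_smul, mul_pow, h1, sq_abs, inv_pow, Real.sq_sqrt hk'.le, inv_mul_cancel₀ hk'.ne']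
    have hsub : E σ ⊆ {ω | ¬ ∃ y, Uᵀ *ᵥ (S ω *ᵥ y) = a ∧ l2 (S ω *ᵥ y) ^ 2 ≤ K * d} := by
      rintro ω hω ⟨y, hy1, hy2⟩
      refine hω ⟨Real.sqrt k • y, ?_, ?_⟩
      · rw [mulVec_smul, mulVec_smul, hy1, ha, smul_smul, mul_inv_cancel₀ hsq.ne', one_smul]
      · rw [mulVec_smul, l2_smul, mul_pow, sq_abs, Real.sq_sqrt hk'.le]
        exact mul_le_mul_of_nonneg_left hy2 hk'.le
    refine (measure_mono hsub).trans
      ((measure_not_solvable_le hS hind hd hU ha1 hK0 hτ0).trans (le_of_eq ?_))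
    rw [← ENNReal.ofReal_add hτ0.le (by positivity)]
    congr 1
    rw [hK]
    field_simp
    ring
  have hmk := mul_measure_le_sum_measure P
    {ω | ¬ TanLE U W (S ω) (Real.sqrt (4 * (k * (K * d))))} E (3 / 16 * 2 ^ k) (by
      intro ω hω
      by_contra hlt
      rw [not_le] at hlt
      apply hω
      refine tanLE_of_card_badSign_lt h (by positivity) (lt_of_le_of_lt (le_of_eq ?_) hlt)
      rw [Finset.card_filter, Nat.cast_sum]
      refine Finset.sum_congr rfl fun σ _ => ?_
      simp [Set.indicator_apply, hE])
  have hsum : ∑ σ, P (E σ) ≤ ENNReal.ofReal (3 / 16 * 2 ^ k) * ENNReal.ofReal δ := by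
    refine (Finset.sum_le_sum fun σ _ => hPE σ).trans (le_of_eq ?_)
    rw [Finset.sum_const, Finset.card_univ, Fintype.card_fun, Fintype.card_bool, Fintype.card_fin,
      nsmul_eq_mul, ← ENNReal.ofReal_natCast, ← ENNReal.ofReal_mul (by positivity),
      ← ENNReal.ofReal_mul (by positivity)]
    congr 1
    rw [hτ]
    push_cast
    ring
  refine (ENNReal.mul_le_mul_iff_right ?_ ENNReal.ofReal_ne_top).1 (hmk.trans hsum)
  exact (ENNReal.ofReal_pos.2 (by positivity)).ne'

end GaussianMatrix

/-! ### The parameters of the algorithm -/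

section Parameters

variable {lam lamBar : ℝ}

lemma lamTilde_lt (h0 : 0 ≤ lamBar) (hl : lamBar < lam) : lamTilde lam lamBar < lam :=
  max_lt hl (by linarith)

lemma lamTilde_pos (h0 : 0 ≤ lamBar) (hl : lamBar < lam) : 0 < lamTilde lam lamBar :=
  lt_of_lt_of_le (by linarith) (le_max_right _ _)

lemma gam_pos (h0 : 0 ≤ lamBar) (hl : lamBar < lam) : 0 < gam lam lamBar :=
  Real.rpow_pos_of_pos (div_pos (lamTilde_pos h0 hl) (by linarith)) _

lemma gam_lt_one (h0 : 0 ≤ lamBar) (hl : lamBar < lam) : gam lam lamBar < 1 :=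
  Real.rpow_lt_one (div_pos (lamTilde_pos h0 hl) (by linarith)).le
    ((div_lt_one (by linarith)).2 (lamTilde_lt h0 hl)) (by norm_num)

lemma gam_pow_four (h0 : 0 ≤ lamBar) (hl : lamBar < lam) :
    gam lam lamBar ^ 4 = lamTilde lam lamBar / lam := by
  rw [gam, ← Real.rpow_natCast, ← Real.rpow_mul (div_pos (lamTilde_pos h0 hl) (by linarith)).le]
  norm_num

lemma lamTilde_eq (h0 : 0 ≤ lamBar) (hl : lamBar < lam) :
    lamTilde lam lamBar = gam lam lamBar ^ 4 * lam := by
  rw [gam_pow_four h0 hl, div_mul_cancel₀ _ (by linarith)]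

lemma gap_eq (h0 : 0 ≤ lamBar) (hl : lamBar < lam) :
    gap lam lamBar = lam * (1 - gam lam lamBar ^ 4) / 4 := by
  rw [gap, lamTilde_eq h0 hl]; ring

lemma gap_pos (h0 : 0 ≤ lamBar) (hl : lamBar < lam) : 0 < gap lam lamBar := by
  have := lamTilde_lt h0 hl
  unfold gap; linarith

lemma sub_le_gap (h0 : 0 ≤ lamBar) (hl : lamBar < lam) :
    3 / 16 * (lam - lamBar) ≤ gap lam lamBar := by
  have : lamTilde lam lamBar ≤ lam - 3 / 4 * (lam - lamBar) :=
    max_le (by linarith) (by linarith)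
  unfold gap; linarith

lemma half_le_gam_sq (h0 : 0 ≤ lamBar) (hl : lamBar < lam) : 1 / 2 ≤ gam lam lamBar ^ 2 := by
  have h1 : 1 / 4 ≤ gam lam lamBar ^ 4 := by
    rw [gam_pow_four h0 hl, le_div_iff₀ (by linarith)]
    exact le_trans (by linarith) (le_max_right _ _)
  nlinarith [sq_nonneg (gam lam lamBar)]

/-- The logarithmic rate of decay of the error bounds is at least `Δ / λ`. -/
lemma gap_div_le_neg_log_gam (h0 : 0 ≤ lamBar) (hl : lamBar < lam) :
    gap lam lamBar / lam ≤ -Real.log (gam lam lamBar) := by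
  have hlam : 0 < lam := by linarith
  have h1 := Real.log_le_sub_one_of_pos (pow_pos (gam_pos h0 hl) 4)
  rw [Real.log_pow] at h1
  rw [gap_eq h0 hl, div_div, mul_comm (4 : ℝ), mul_div_mul_left _ _ hlam.ne']
  push_cast at h1
  linarith

lemma inv_one_sub_gam_sq_le (h0 : 0 ≤ lamBar) (hl : lamBar < lam) :
    (1 - gam lam lamBar ^ 2)⁻¹ ≤ lam / (2 * gap lam lamBar) := by
  have hlam : 0 < lam := by linarith
  have hg0 := gam_pos h0 hl
  have hg1 : gam lam lamBar ^ 2 < 1 := pow_lt_one₀ hg0.le (gam_lt_one h0 hl) two_ne_zero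
  have h1 : 0 < 1 - gam lam lamBar ^ 2 := by linarith
  rw [inv_le_comm₀ h1 (div_pos hlam (by linarith [gap_pos h0 hl])), inv_div, div_le_iff₀ hlam,
    gap_eq h0 hl]
  have : 1 - gam lam lamBar ^ 4 = (1 - gam lam lamBar ^ 2) * (1 + gam lam lamBar ^ 2) := by ring
  rw [this]
  nlinarith [mul_pos hlam h1]

/-- With a perturbation of size `Δ β` one iteration multiplies the tangent bound `t` by at most
`γ`. -/
lemma step_ratio_le (h0 : 0 ≤ lamBar) (hl : lamBar < lam) {t : ℝ} (ht : 0 < t) {η : ℝ}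
    (hη : η = gap lam lamBar *
      min (gam lam lamBar / Real.sqrt (1 + t ^ 2)) (gam lam lamBar * t)) :
    η * Real.sqrt (1 + t ^ 2) < lam ∧
    (lamBar * t + η * Real.sqrt (1 + t ^ 2)) / (lam - η * Real.sqrt (1 + t ^ 2)) ≤
      gam lam lamBar * t := by
  have hlam : 0 < lam := by linarith
  set g := gam lam lamBar with hg
  have hg0 : 0 < g := gam_pos h0 hl
  have hg1 : g < 1 := gam_lt_one h0 hl
  set Δ := gap lam lamBar with hΔ
  have hΔ0 : 0 < Δ := gap_pos h0 hl
  have hΔe : Δ = lam * (1 - g ^ 4) / 4 := gap_eq h0 hl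
  set ρ := Real.sqrt (1 + t ^ 2) with hρ
  have hρ0 : 0 < ρ := Real.sqrt_pos.2 (by positivity)
  have h1 : min (g / ρ) (g * t) * ρ ≤ g := by
    calc _ ≤ g / ρ * ρ := mul_le_mul_of_nonneg_right (min_le_left _ _) hρ0.le
      _ = g := div_mul_cancel₀ _ hρ0.ne'
  have h2 : min (g / ρ) (g * t) * ρ ≤ 3 / 2 * (g * t) := by
    rcases le_total t 1 with h | h
    · have hρ2 : ρ ≤ 3 / 2 := Real.sqrt_le_iff.2 ⟨by norm_num, by nlinarith⟩
      calc _ ≤ g * t * (3 / 2) :=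
            mul_le_mul (min_le_right _ _) hρ2 hρ0.le (by positivity)
        _ = _ := by ring
    · nlinarith
  have h3 : η * ρ ≤ Δ * g := by
    rw [hη, mul_assoc]; exact mul_le_mul_of_nonneg_left h1 hΔ0.le
  have h4 : η * ρ ≤ Δ * (3 / 2 * (g * t)) := by
    rw [hη, mul_assoc]; exact mul_le_mul_of_nonneg_left h2 hΔ0.le
  have hg4 : g ^ 4 < 1 := pow_lt_one₀ hg0.le hg1 (by norm_num)
  have hg4' : 0 < g ^ 4 := by positivity
  have h5 : Δ * g < lam := by
    have : Δ < lam := by rw [hΔe]; nlinarith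
    nlinarith
  have hlt : η * ρ < lam := lt_of_le_of_lt h3 h5
  refine ⟨hlt, ?_⟩
  rw [div_le_iff₀ (by linarith)]
  have hbar : lamBar ≤ g ^ 4 * lam := by
    rw [← lamTilde_eq h0 hl]; exact le_max_left _ _
  -- since `Δ = λ (1 - γ⁴) / 4`, this reduces to `3 (1 - γ⁴) ≤ 4 (1 - γ³)`
  have hkey : g ^ 3 * lam + 3 / 2 * Δ ≤ lam - Δ * g := by
    have h6 : (1 - g ^ 4) * 3 ≤ 4 * (1 - g ^ 3) := by
      have : 4 * (1 - g ^ 3) - (1 - g ^ 4) * 3 = (1 - g) ^ 2 * (1 + 2 * g + 3 * g ^ 2) := by ring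
      nlinarith [mul_nonneg (sq_nonneg (1 - g)) (show 0 ≤ 1 + 2 * g + 3 * g ^ 2 by positivity)]
    have h7 : (1 - g ^ 4) * (3 / 2 + g) ≤ 4 * (1 - g ^ 3) := by nlinarith
    rw [hΔe]
    nlinarith
  have h8 : lamBar * t ≤ g ^ 4 * lam * t := mul_le_mul_of_nonneg_right hbar ht.le
  have h9 := mul_le_mul_of_nonneg_left hkey (mul_pos hg0 ht).le
  have h10 := mul_le_mul_of_nonneg_left h3 (mul_pos hg0 ht).le
  nlinarith

variable {d k : ℕ} {cbar c δ₀ : ℝ}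

lemma errBound_pos (h0 : 0 ≤ lamBar) (hl : lamBar < lam) (hd : 0 < d) (hk : 0 < k) (hc : 0 < cbar)
    (i : ℕ) : 0 < errBound d k cbar lam lamBar i := by
  have : (0 : ℝ) < d := by exact_mod_cast hd
  have : (0 : ℝ) < k := by exact_mod_cast hk
  exact mul_pos (Real.sqrt_pos.2 (by positivity)) (pow_pos (gam_pos h0 hl) i)

lemma errBound_succ (i : ℕ) : errBound d k cbar lam lamBar (i + 1) =
    gam lam lamBar * errBound d k cbar lam lamBar i := by
  unfold errBound; ring

lemma errBound_antitone (h0 : 0 ≤ lamBar) (hl : lamBar < lam) :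
    Antitone (errBound d k cbar lam lamBar) := fun _ _ hij =>
  mul_le_mul_of_nonneg_left
    (pow_le_pow_of_le_one (gam_pos h0 hl).le (gam_lt_one h0 hl).le hij) (Real.sqrt_nonneg _)

lemma beta_pos (h0 : 0 ≤ lamBar) (hl : lamBar < lam) (hd : 0 < d) (hk : 0 < k) (hc : 0 < cbar)
    (i : ℕ) : 0 < beta d k cbar lam lamBar i :=
  lt_min (div_pos (gam_pos h0 hl) (Real.sqrt_pos.2 (by positivity)))
    (mul_pos (gam_pos h0 hl) (errBound_pos h0 hl hd hk hc _))

lemma beta_le_one (h0 : 0 ≤ lamBar) (hl : lamBar < lam) (i : ℕ) :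
    beta d k cbar lam lamBar i ≤ 1 := by
  refine (min_le_left _ _).trans ?_
  have h1 : 1 ≤ Real.sqrt (1 + errBound d k cbar lam lamBar (i - 1) ^ 2) :=
    Real.one_le_sqrt.2 (by linarith [sq_nonneg (errBound d k cbar lam lamBar (i - 1))])
  exact (div_le_one (by linarith)).2 ((gam_lt_one h0 hl).le.trans h1)

lemma failProb_pos (hδ : 0 < δ₀) {i : ℕ} (hi : 1 ≤ i) : 0 < failProb δ₀ i := by
  have : (0 : ℝ) < i := by exact_mod_cast hi
  unfold failProb; positivity

lemma failProb_le_half (hδ1 : δ₀ < 1) {i : ℕ} (hi : 1 ≤ i) :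
    failProb δ₀ i ≤ 1 / 2 := by
  have : (1 : ℝ) ≤ i := by exact_mod_cast hi
  unfold failProb
  rw [div_le_iff₀ (by positivity)]
  nlinarith

lemma one_le_log_div_failProb (hδ : 0 < δ₀) (hδ1 : δ₀ < 1) (hd : 2 ≤ d) {i : ℕ} (hi : 1 ≤ i) :
    1 ≤ Real.log (d / failProb δ₀ i) := by
  have hd' : (2 : ℝ) ≤ d := by exact_mod_cast hd
  have h1 := failProb_pos hδ hi
  have h2 := failProb_le_half hδ1 hi
  rw [Real.le_log_iff_exp_le (by positivity), le_div_iff₀ h1]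
  have := Real.exp_one_lt_d9
  nlinarith

lemma le_blockSize (h0 : 0 ≤ lamBar) (hl : lamBar < lam) (hd : 0 < d) (hk : 0 < k) (hc : 0 < cbar)
    (i : ℕ) : c * Real.log (d / failProb δ₀ i) ≤
      blockSize d k δ₀ cbar c lam lamBar i *
        (gap lam lamBar * beta d k cbar lam lamBar i) ^ 2 := by
  have h1 : 0 < (gap lam lamBar * beta d k cbar lam lamBar i) ^ 2 :=
    pow_pos (mul_pos (gap_pos h0 hl) (beta_pos h0 hl hd hk hc i)) 2
  have h2 : c / (gap lam lamBar * beta d k cbar lam lamBar i) ^ 2 * Real.log (d / failProb δ₀ i) ≤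
    blockSize d k δ₀ cbar c lam lamBar i := Nat.le_ceil _
  rw [div_mul_eq_mul_div, div_le_iff₀ h1] at h2
  exact h2

lemma blockSize_le (h0 : 0 ≤ lamBar) (hl : lamBar < lam) (hl1 : lam ≤ 1) (hd : 2 ≤ d) (hk : 0 < k)
    (hcb : 0 < cbar) (hδ : 0 < δ₀) (hδ1 : δ₀ < 1) (hc : 16 ≤ c) {i : ℕ} (hi : 1 ≤ i) :
    (blockSize d k δ₀ cbar c lam lamBar i : ℝ) ≤
      2 * (c / (gap lam lamBar * beta d k cbar lam lamBar i) ^ 2 *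
        Real.log (d / failProb δ₀ i)) := by
  have hb := beta_pos (d := d) h0 hl (by omega) hk hcb i
  have hΔ := gap_pos h0 hl
  have h1 : 0 < gap lam lamBar * beta d k cbar lam lamBar i := mul_pos hΔ hb
  have h2 : gap lam lamBar * beta d k cbar lam lamBar i ≤ 1 := by
    have h3 : gap lam lamBar ≤ 1 := by
      have := lamTilde_pos h0 hl
      unfold gap; linarith
    exact mul_le_one₀ h3 hb.le (beta_le_one h0 hl i)
  have h3 := one_le_log_div_failProb hδ hδ1 hd hi
  have h4 : 1 ≤ c / (gap lam lamBar * beta d k cbar lam lamBar i) ^ 2 := by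
    rw [le_div_iff₀ (pow_pos h1 2)]
    have := pow_le_one₀ (n := 2) h1.le h2
    linarith
  have h5 : 1 ≤ c / (gap lam lamBar * beta d k cbar lam lamBar i) ^ 2 *
        Real.log (d / failProb δ₀ i) := one_le_mul_of_one_le_of_one_le h4 h3
  have h6 := (Nat.ceil_lt_add_one (le_trans zero_le_one h5)).le
  unfold blockSize
  linarith

lemma inv_beta_sq_le (h0 : 0 ≤ lamBar) (hl : lamBar < lam) (hd : 0 < d) (hk : 0 < k)
    (hc : 0 < cbar) (i : ℕ) : (beta d k cbar lam lamBar (i + 1) ^ 2)⁻¹ ≤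
      3 * (errBound d k cbar lam lamBar i ^ 2 + (errBound d k cbar lam lamBar i ^ 2)⁻¹) := by
  unfold beta
  rw [Nat.add_sub_cancel]
  set e := errBound d k cbar lam lamBar i
  have he : 0 < e := errBound_pos h0 hl hd hk hc i
  set g := gam lam lamBar
  have hg : 0 < g := gam_pos h0 hl
  have hg2 : 1 / 2 ≤ g ^ 2 := half_le_gam_sq h0 hl
  have hginv : (g ^ 2)⁻¹ ≤ 2 := by
    rw [inv_le_comm₀ (by positivity) (by norm_num)]; linarith
  have he2 : 0 < e ^ 2 := by positivity
  have hinv : e ^ 2 * (e ^ 2)⁻¹ = 1 := mul_inv_cancel₀ he2.ne'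
  have hinv0 : 0 < (e ^ 2)⁻¹ := by positivity
  have h2 : 2 ≤ e ^ 2 + (e ^ 2)⁻¹ := by nlinarith [sq_nonneg (e ^ 2 - (e ^ 2)⁻¹)]
  rcases min_choice (g / Real.sqrt (1 + e ^ 2)) (g * e) with h | h <;> rw [h]
  · rw [div_pow, Real.sq_sqrt (by positivity), inv_div, div_eq_mul_inv]
    calc (1 + e ^ 2) * (g ^ 2)⁻¹ ≤ (1 + e ^ 2) * 2 := by gcongr
      _ ≤ _ := by linarith
  · rw [mul_pow, mul_inv]
    calc (g ^ 2)⁻¹ * (e ^ 2)⁻¹ ≤ 2 * (e ^ 2)⁻¹ := by gcongr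
      _ ≤ _ := by linarith

lemma geom_sum_le {r : ℝ} (hr0 : 0 ≤ r) (hr1 : r < 1) (n : ℕ) :
    ∑ i ∈ Finset.range n, r ^ i ≤ (1 - r)⁻¹ := by
  rw [← tsum_geometric_of_lt_one hr0 hr1]
  exact (summable_geometric_of_lt_one hr0 hr1).sum_le_tsum _ fun i _ => pow_nonneg hr0 i

lemma sum_errBound_sq_le (h0 : 0 ≤ lamBar) (hl : lamBar < lam) (n : ℕ) :
    ∑ i ∈ Finset.range n, errBound d k cbar lam lamBar i ^ 2 ≤
      errBound d k cbar lam lamBar 0 ^ 2 * (1 - gam lam lamBar ^ 2)⁻¹ := by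
  have hg2 : gam lam lamBar ^ 2 < 1 :=
    pow_lt_one₀ (gam_pos h0 hl).le (gam_lt_one h0 hl) two_ne_zero
  have h1 : ∀ i, errBound d k cbar lam lamBar i ^ 2 =
      errBound d k cbar lam lamBar 0 ^ 2 * (gam lam lamBar ^ 2) ^ i := by
    intro i; unfold errBound; rw [pow_zero, ← pow_mul]; ring
  rw [Finset.sum_congr rfl fun i _ => h1 i, ← Finset.mul_sum]
  refine mul_le_mul_of_nonneg_left ?_ (sq_nonneg _)
  exact geom_sum_le (sq_nonneg _) hg2 n

/-- The sum of the inverse squares is dominated by its last term, up to the factor of a geometric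
series. -/
lemma sum_inv_errBound_sq_le (h0 : 0 ≤ lamBar) (hl : lamBar < lam) (n : ℕ) :
    ∑ i ∈ Finset.range (n + 1), (errBound d k cbar lam lamBar i ^ 2)⁻¹ ≤
      (errBound d k cbar lam lamBar n ^ 2)⁻¹ * (1 - gam lam lamBar ^ 2)⁻¹ := by
  have hg := gam_pos h0 hl
  have hg2 : gam lam lamBar ^ 2 < 1 := pow_lt_one₀ hg.le (gam_lt_one h0 hl) two_ne_zero
  have h1 : ∀ i ∈ Finset.range (n + 1), (errBound d k cbar lam lamBar (n + 1 - 1 - i) ^ 2)⁻¹ =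
      (errBound d k cbar lam lamBar n ^ 2)⁻¹ * (gam lam lamBar ^ 2) ^ i := by
    intro i hi
    have hi' : i ≤ n := Nat.lt_succ_iff.1 (Finset.mem_range.1 hi)
    have h2 : errBound d k cbar lam lamBar n =
        errBound d k cbar lam lamBar (n - i) * gam lam lamBar ^ i := by
      unfold errBound
      rw [mul_assoc, ← pow_add, Nat.sub_add_cancel hi']
    rw [Nat.add_sub_cancel, h2, mul_pow, mul_inv, ← pow_mul, ← pow_mul, mul_comm i, mul_assoc,
      inv_mul_cancel₀ (pow_pos hg _).ne', mul_one]
  rw [← Finset.sum_range_reflect, Finset.sum_congr rfl h1, ← Finset.mul_sum]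
  refine mul_le_mul_of_nonneg_left ?_ (by positivity)
  exact geom_sum_le (sq_nonneg _) hg2 _

lemma log_div_failProb_le (hδ : 0 < δ₀) (hδ1 : δ₀ < 1) (hd : 2 ≤ d) {i L : ℕ} (hi : 1 ≤ i)
    (hiL : i ≤ L) :
    Real.log (d / failProb δ₀ i) ≤ (2 + 2 * Real.log (2 / δ₀)) * Real.log (d * L) := by
  have hd' : (2 : ℝ) ≤ d := by exact_mod_cast hd
  have hi' : (1 : ℝ) ≤ i := by exact_mod_cast hi
  have hL' : (i : ℝ) ≤ L := by exact_mod_cast hiL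
  have hdL : 2 ≤ (d : ℝ) * L := by nlinarith
  have hlog : 1 / 2 ≤ Real.log (d * L) := by
    refine le_trans ?_ (Real.log_le_log (by norm_num) hdL)
    have := Real.log_two_gt_d9
    linarith
  have h2 : 0 ≤ Real.log (2 / δ₀) := Real.log_nonneg ((one_le_div hδ).2 (by linarith))
  calc Real.log (d / failProb δ₀ i) ≤ Real.log (2 / δ₀ * (d * L) ^ 2) := by
        apply Real.log_le_log (div_pos (by linarith) (failProb_pos hδ hi))
        have : (d : ℝ) / failProb δ₀ i = 2 / δ₀ * (d * i ^ 2) := by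
          unfold failProb; field_simp
        rw [this]
        apply mul_le_mul_of_nonneg_left _ (by positivity)
        rw [mul_pow]
        have h3 : (d : ℝ) ≤ d ^ 2 := by nlinarith
        have h4 : (i : ℝ) ^ 2 ≤ L ^ 2 := by gcongr
        exact mul_le_mul h3 h4 (by positivity) (by positivity)
    _ = Real.log (2 / δ₀) + 2 * Real.log (d * L) := by
        rw [Real.log_mul (by positivity) (by positivity), Real.log_pow]
        norm_num
    _ ≤ _ := by nlinarith

end Parameters

/-! ### Iteration count, sample count, and the run of the algorithm -/

section Complexity

variable {lam lamBar ε cbar c δ₀ : ℝ} {d k : ℕ}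

lemma sq_mul_le_one_of_le (hk : 1 ≤ k) (hkd : k < d) (hε : 0 < ε)
    (hεd : ε ≤ 1 / Real.sqrt ((k : ℝ) * d)) : ε ^ 2 * (k * d) ≤ 1 := by
  have hdr : (0 : ℝ) < d := by exact_mod_cast (by omega : 0 < d)
  have hkr : (0 : ℝ) < k := by exact_mod_cast hk
  have h1 : ε * Real.sqrt ((k : ℝ) * d) ≤ 1 :=
    (le_div_iff₀ (Real.sqrt_pos.2 (by positivity))).1 hεd
  have h2 := pow_le_one₀ (n := 2) (by positivity) h1
  rwa [mul_pow, Real.sq_sqrt (by positivity)] at h2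

lemma errBound_zero_sq (hcb : 0 < cbar) :
    errBound d k cbar lam lamBar 0 ^ 2 = (d : ℝ) * k / cbar := by
  rw [errBound, pow_zero, mul_one, Real.sq_sqrt (by positivity)]

/-- The number of iterations during which the error bound exceeds `ε`. -/
lemma iteration_count_le (h0 : 0 ≤ lamBar) (hl : lamBar < lam) (hk : 1 ≤ k) (hkd : k < d)
    (hcb : 0 < cbar) (hcb1 : cbar ≤ 1) (hε : 0 < ε) (hε1 : ε < 1) {m : ℕ}
    (hmε : ε < errBound d k cbar lam lamBar m) :
    (m : ℝ) + 1 ≤ (8 + 12 * Real.log (1 / cbar)) * (lam / (lam - lamBar) * Real.log (d / ε)) := by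
  have hlam : 0 < lam := by linarith
  have hdr : (2 : ℝ) ≤ d := by exact_mod_cast (by omega : 2 ≤ d)
  have hkr : (1 : ℝ) ≤ k := by exact_mod_cast hk
  have hkdr : (k : ℝ) ≤ d := by exact_mod_cast hkd.le
  have hg0 := gam_pos h0 hl
  have hsub : 0 < lam - lamBar := by linarith
  have he0 : 0 < errBound d k cbar lam lamBar 0 := errBound_pos h0 hl (by omega) hk hcb 0
  have hlogc : 0 ≤ Real.log (1 / cbar) := Real.log_nonneg ((one_le_div hcb).2 hcb1)
  have hℓ : 1 / 2 ≤ Real.log (d / ε) := by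
    have h1 : 2 ≤ d / ε := by rw [le_div_iff₀ hε]; nlinarith
    have := Real.log_le_log (by norm_num) h1
    have := Real.log_two_gt_d9
    linarith
  have hD : 1 ≤ lam / (lam - lamBar) := (one_le_div hsub).2 (by linarith)
  have hbnd : Real.log (errBound d k cbar lam lamBar 0 / ε) ≤
      Real.log (d / ε) + Real.log (1 / cbar) := by
    rw [← Real.log_mul (by positivity) (by positivity)]
    apply Real.log_le_log (by positivity)
    have h1 : errBound d k cbar lam lamBar 0 ≤ d * (1 / cbar) := by
      refine le_of_sq_le_sq ?_ (by positivity)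
      rw [errBound_zero_sq hcb, mul_pow, div_pow, one_pow, mul_one_div,
        div_le_div_iff₀ hcb (by positivity)]
      have h2 : (d : ℝ) * k ≤ d ^ 2 := by nlinarith
      have h3 : cbar ^ 2 ≤ cbar := by nlinarith
      exact mul_le_mul h2 h3 (by positivity) (by positivity)
    calc errBound d k cbar lam lamBar 0 / ε ≤ d * (1 / cbar) / ε := by gcongr
      _ = _ := by ring
  have hmlog : m * (gap lam lamBar / lam) ≤
      Real.log (errBound d k cbar lam lamBar 0 / ε) := by
    have h1 : 1 < errBound d k cbar lam lamBar m / ε := (one_lt_div hε).2 hmε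
    have h2 : errBound d k cbar lam lamBar m / ε =
        errBound d k cbar lam lamBar 0 / ε * gam lam lamBar ^ m := by
      unfold errBound; ring
    have h3 := Real.log_pos h1
    rw [h2, Real.log_mul (by positivity) (by positivity), Real.log_pow] at h3
    have h4 := mul_le_mul_of_nonneg_left (gap_div_le_neg_log_gam h0 hl)
      (Nat.cast_nonneg (α := ℝ) m)
    linarith
  have hm1 : (m : ℝ) ≤ 16 / 3 * (lam / (lam - lamBar)) *
      (Real.log (d / ε) + Real.log (1 / cbar)) := by
    have h1 : 3 / 16 * ((lam - lamBar) / lam) ≤ gap lam lamBar / lam := by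
      rw [mul_div_assoc']
      exact div_le_div_of_nonneg_right (sub_le_gap h0 hl) hlam.le
    have h2 := (mul_le_mul_of_nonneg_left h1 (Nat.cast_nonneg (α := ℝ) m)).trans
      (hmlog.trans hbnd)
    have h3 : (m : ℝ) = 16 / 3 * (lam / (lam - lamBar)) *
        (m * (3 / 16 * ((lam - lamBar) / lam))) := by field_simp
    rw [h3]
    exact mul_le_mul_of_nonneg_left h2 (by positivity)
  set D := lam / (lam - lamBar)
  set ℓ := Real.log (d / ε)
  set lc := Real.log (1 / cbar)
  have h1 : 1 ≤ 2 * (D * ℓ) := by nlinarith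
  have h2 : D * lc ≤ 2 * (D * ℓ) * lc := by
    have := mul_le_mul_of_nonneg_left hℓ (show 0 ≤ D * lc by positivity)
    linarith
  have h3 : 0 ≤ D * ℓ * lc := by positivity
  nlinarith

lemma blockSize_le_of_lt (h0 : 0 ≤ lamBar) (hl : lamBar < lam) (hl1 : lam ≤ 1) (hd : 2 ≤ d)
    (hk : 0 < k) (hcb : 0 < cbar) (hδ : 0 < δ₀) (hδ1 : δ₀ < 1) (hc : 16 ≤ c) {i L : ℕ}
    (hi : i < L) :
    (blockSize d k δ₀ cbar c lam lamBar (i + 1) : ℝ) ≤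
      6 * c * (2 + 2 * Real.log (2 / δ₀)) * Real.log (d * L) / gap lam lamBar ^ 2 *
        (errBound d k cbar lam lamBar i ^ 2 + (errBound d k cbar lam lamBar i ^ 2)⁻¹) := by
  refine (blockSize_le h0 hl hl1 hd hk hcb hδ hδ1 hc (Nat.le_add_left 1 i)).trans ?_
  have h1 := log_div_failProb_le hδ hδ1 hd (Nat.le_add_left 1 i) (Nat.succ_le_of_lt hi)
  have h2 := inv_beta_sq_le h0 hl (show 0 < d by omega) hk hcb i
  have h3 : 0 ≤ Real.log (d / failProb δ₀ (i + 1)) :=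
    zero_le_one.trans (one_le_log_div_failProb hδ hδ1 hd (Nat.le_add_left 1 i))
  set Λ := (2 + 2 * Real.log (2 / δ₀)) * Real.log (d * L) with hΛ
  set B := (beta d k cbar lam lamBar (i + 1) ^ 2)⁻¹ with hB
  set e := errBound d k cbar lam lamBar i ^ 2
  have he : 0 ≤ e := sq_nonneg _
  set Δ := gap lam lamBar
  have hΔ : 0 < Δ := gap_pos h0 hl
  calc 2 * (c / (Δ * beta d k cbar lam lamBar (i + 1)) ^ 2 * Real.log (d / failProb δ₀ (i + 1)))
      = 2 * c / Δ ^ 2 * (B * Real.log (d / failProb δ₀ (i + 1))) := by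
        rw [mul_pow, div_eq_mul_inv c, mul_inv, ← hB, div_eq_mul_inv (2 * c)]; ring
    _ ≤ 2 * c / Δ ^ 2 * (3 * (e + e⁻¹) * Λ) := by
        apply mul_le_mul_of_nonneg_left _ (by positivity)
        exact mul_le_mul h2 h1 h3 (by positivity)
    _ = _ := by rw [hΛ]; ring

/-- The number of samples in the first `m + 1` blocks, if the error bound exceeds `ε` before the
last of them. -/
lemma sum_blockSize_le (h0 : 0 ≤ lamBar) (hl : lamBar < lam) (hl1 : lam ≤ 1) (hd : 2 ≤ d)
    (hk : 0 < k) (hcb : 0 < cbar) (hδ : 0 < δ₀) (hδ1 : δ₀ < 1) (hc : 16 ≤ c) (hε : 0 < ε)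
    (hεd : ε ^ 2 * (k * d) ≤ 1) {m : ℕ} (hmε : ε < errBound d k cbar lam lamBar m) :
    ((∑ i ∈ Finset.Icc 1 (m + 1), blockSize d k δ₀ cbar c lam lamBar i : ℕ) : ℝ) ≤
      (456 * c * (2 + 2 * Real.log (2 / δ₀)) * (1 / cbar + 1)) *
        (lam * Real.log (d * (m + 1 : ℕ)) / (ε ^ 2 * (lam - lamBar) ^ 3)) := by
  have hlam : 0 < lam := by linarith
  have hdr : (2 : ℝ) ≤ d := by exact_mod_cast hd
  have hsub : 0 < lam - lamBar := by linarith
  set Λ := Real.log ((d : ℝ) * ((m + 1 : ℕ) : ℝ)) with hΛ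
  set C₂ := 2 + 2 * Real.log (2 / δ₀) with hC₂
  have hC₂0 : 0 ≤ C₂ := by
    have : 0 ≤ Real.log (2 / δ₀) := Real.log_nonneg ((one_le_div hδ).2 (by linarith))
    positivity
  have hΛ0 : 0 ≤ Λ := by
    apply Real.log_nonneg
    push_cast
    nlinarith [(Nat.cast_nonneg m : (0 : ℝ) ≤ m)]
  set Δ := gap lam lamBar with hΔdef
  have hΔ : 0 < Δ := gap_pos h0 hl
  have hgeom : ∑ i ∈ Finset.range (m + 1), (errBound d k cbar lam lamBar i ^ 2 +
      (errBound d k cbar lam lamBar i ^ 2)⁻¹) ≤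
      ((1 / cbar + 1) * (1 / ε ^ 2)) * (lam / (2 * Δ)) := by
    rw [Finset.sum_add_distrib]
    have h2 := sum_errBound_sq_le (d := d) (k := k) (cbar := cbar) h0 hl (m + 1)
    have h3 := sum_inv_errBound_sq_le (d := d) (k := k) (cbar := cbar) h0 hl m
    have h4 := inv_one_sub_gam_sq_le h0 hl
    have h5 : errBound d k cbar lam lamBar 0 ^ 2 ≤ 1 / cbar * (1 / ε ^ 2) := by
      rw [errBound_zero_sq hcb, div_mul_div_comm, one_mul, div_le_div_iff₀ hcb (by positivity)]
      nlinarith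
    have h6 : (errBound d k cbar lam lamBar m ^ 2)⁻¹ ≤ 1 / ε ^ 2 := by
      rw [← one_div]
      exact one_div_le_one_div_of_le (by positivity) (pow_le_pow_left₀ hε.le hmε.le 2)
    have h7 : 0 ≤ (1 - gam lam lamBar ^ 2)⁻¹ := by
      have : gam lam lamBar ^ 2 < 1 :=
        pow_lt_one₀ (gam_pos h0 hl).le (gam_lt_one h0 hl) two_ne_zero
      exact inv_nonneg.2 (by linarith)
    calc _ ≤ (errBound d k cbar lam lamBar 0 ^ 2 + (errBound d k cbar lam lamBar m ^ 2)⁻¹) *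
          (1 - gam lam lamBar ^ 2)⁻¹ := by
          rw [add_mul]; exact add_le_add h2 h3
      _ ≤ _ := by
          apply mul_le_mul _ h4 h7 (by positivity)
          linarith
  have hsum : ((∑ i ∈ Finset.Icc 1 (m + 1), blockSize d k δ₀ cbar c lam lamBar i : ℕ) : ℝ) ≤
      6 * c * C₂ * Λ / Δ ^ 2 * ((1 / cbar + 1) * (1 / ε ^ 2) * (lam / (2 * Δ))) := by
    have h1 : ∑ i ∈ Finset.Icc 1 (m + 1), blockSize d k δ₀ cbar c lam lamBar i =
        ∑ i ∈ Finset.range (m + 1), blockSize d k δ₀ cbar c lam lamBar (i + 1) := by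
      rw [Finset.range_eq_Ico,
        Finset.sum_Ico_add' (fun i => blockSize d k δ₀ cbar c lam lamBar i)]
      rfl
    rw [h1, Nat.cast_sum]
    refine (Finset.sum_le_sum fun i hi => blockSize_le_of_lt h0 hl hl1 hd hk hcb hδ hδ1 hc
      (Finset.mem_range.1 hi)).trans ?_
    rw [← Finset.mul_sum]
    exact mul_le_mul_of_nonneg_left hgeom (by positivity)
  refine hsum.trans ?_
  have hΔ3 : 1 / Δ ^ 3 ≤ 152 / (lam - lamBar) ^ 3 := by
    rw [div_le_div_iff₀ (by positivity) (by positivity)]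
    have := pow_le_pow_left₀ (by positivity) (sub_le_gap h0 hl) 3
    rw [mul_pow] at this
    have : 0 < (lam - lamBar) ^ 3 := by positivity
    linarith
  calc 6 * c * C₂ * Λ / Δ ^ 2 * ((1 / cbar + 1) * (1 / ε ^ 2) * (lam / (2 * Δ)))
      = 3 * c * C₂ * (1 / cbar + 1) * Λ * lam / ε ^ 2 * (1 / Δ ^ 3) := by
        field_simp; ring
    _ ≤ 3 * c * C₂ * (1 / cbar + 1) * Λ * lam / ε ^ 2 * (152 / (lam - lamBar) ^ 3) :=
        mul_le_mul_of_nonneg_left hΔ3 (by positivity)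
    _ = _ := by field_simp; ring

/-- The first iteration `L` after which the error bound is at most `ε`: its size, and the number of
samples used until then. -/
lemma exists_iteration_count (h0 : 0 ≤ lamBar) (hl : lamBar < lam) (hl1 : lam ≤ 1) (hk : 1 ≤ k)
    (hkd : k < d) (hcb : 0 < cbar) (hcb1 : cbar ≤ 1) (hδ : 0 < δ₀) (hδ1 : δ₀ < 1) (hc : 16 ≤ c)
    (hε : 0 < ε) (hεd : ε ≤ 1 / Real.sqrt ((k : ℝ) * d)) :
    ∃ L : ℕ, 1 ≤ L ∧ errBound d k cbar lam lamBar L ≤ ε ∧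
      (L : ℝ) ≤ (8 + 12 * Real.log (1 / cbar)) * (lam / (lam - lamBar) * Real.log (d / ε)) ∧
      ((∑ i ∈ Finset.Icc 1 L, blockSize d k δ₀ cbar c lam lamBar i : ℕ) : ℝ) ≤
        (456 * c * (2 + 2 * Real.log (2 / δ₀)) * (1 / cbar + 1)) *
          (lam * Real.log (d * L) / (ε ^ 2 * (lam - lamBar) ^ 3)) := by
  have hd2 : 2 ≤ d := by omega
  have hdr : (2 : ℝ) ≤ d := by exact_mod_cast hd2
  have hkr : (1 : ℝ) ≤ k := by exact_mod_cast hk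
  have hkd2 : 2 ≤ (k : ℝ) * d := by nlinarith
  have hε2 := sq_mul_le_one_of_le hk hkd hε hεd
  have hε1 : ε < 1 := by
    have h1 : ε ^ 2 < 1 := by nlinarith [sq_nonneg ε]
    nlinarith
  have he0 := errBound_pos h0 hl (by omega : 0 < d) hk hcb 0
  have he01 : 1 ≤ errBound d k cbar lam lamBar 0 := by
    refine le_of_sq_le_sq ?_ he0.le
    rw [errBound_zero_sq hcb, le_div_iff₀ hcb]
    nlinarith
  have hex : ∃ n, errBound d k cbar lam lamBar n ≤ ε := by
    obtain ⟨n, hn⟩ := exists_pow_lt_of_lt_one (div_pos hε he0) (gam_lt_one h0 hl)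
    refine ⟨n, ?_⟩
    rw [lt_div_iff₀ he0] at hn
    have h2 : errBound d k cbar lam lamBar n =
        gam lam lamBar ^ n * errBound d k cbar lam lamBar 0 := by
      unfold errBound; ring
    rw [h2]
    exact hn.le
  classical
  obtain ⟨m, hm⟩ : ∃ m, Nat.find hex = m + 1 := by
    apply Nat.exists_eq_succ_of_ne_zero
    intro h
    have := Nat.find_spec hex
    rw [h] at this
    linarith
  have hmε : ε < errBound d k cbar lam lamBar m := not_le.1 (Nat.find_min hex (by omega))
  refine ⟨m + 1, by omega, hm ▸ Nat.find_spec hex, ?_, ?_⟩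
  · push_cast
    exact iteration_count_le h0 hl hk hkd hcb hcb1 hε hε1 hmε
  · exact sum_blockSize_le h0 hl hl1 hd2 hk hcb hδ hδ1 hc hε hε2 hmε

end Complexity

section Run

lemma tsum_failProb_le {δ₀ : ℝ} (hδ : 0 < δ₀) :
    ∑' i : ℕ, ENNReal.ofReal (failProb δ₀ (i + 1)) ≤ ENNReal.ofReal δ₀ := by
  refine ENNReal.tsum_le_of_sum_range_le fun n => ?_
  rw [← ENNReal.ofReal_sum_of_nonneg fun i _ => (failProb_pos hδ (Nat.le_add_left 1 i)).le]
  apply ENNReal.ofReal_le_ofReal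
  -- for `n = 0` the term `1 / n` is zero, and the bound still holds
  have h : ∀ n : ℕ, ∑ i ∈ Finset.range n, failProb δ₀ (i + 1) ≤ δ₀ / 2 * (2 - 1 / n) := by
    intro n
    induction n with
    | zero => simp; linarith
    | succ n ih =>
      rw [Finset.sum_range_succ]
      rcases Nat.eq_zero_or_pos n with rfl | hn
      · simp [failProb]; linarith
      · have hn' : (0 : ℝ) < n := by exact_mod_cast hn
        have h1 : failProb δ₀ (n + 1) ≤ δ₀ / 2 * (1 / n - 1 / (n + 1)) := by
          unfold failProb
          push_cast
          rw [← div_div]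
          rw [div_eq_mul_one_div (δ₀ / 2)]
          apply mul_le_mul_of_nonneg_left _ (by positivity)
          rw [div_sub_div _ _ hn'.ne' (by positivity),
            div_le_div_iff₀ (by positivity) (by positivity)]
          nlinarith
        push_cast
        linarith
  refine (h n).trans ?_
  have : (0 : ℝ) ≤ 1 / n := by positivity
  nlinarith

variable {d k : ℕ} {lam lamBar cbar c δ₀ : ℝ} {A V : Matrix (Fin d) (Fin d) ℝ}
  {U : Matrix (Fin d) (Fin k) ℝ} {κ : Type*} [Fintype κ] {W : Matrix (Fin d) κ ℝ}

/-- The set of indices of the data points in block `i + 1`. -/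
def block (size : ℕ → ℕ) (i : ℕ) : Finset ℕ :=
  Finset.Ioc (∑ j ∈ Finset.Icc 1 i, size j) (∑ j ∈ Finset.Icc 1 (i + 1), size j)

lemma card_block (size : ℕ → ℕ) (i : ℕ) : (block size i).card = size (i + 1) := by
  rw [block, Nat.card_Ioc, Finset.sum_Icc_succ_top (Nat.le_add_left 1 i), Nat.add_sub_cancel_left]

/-- The empirical second moment matrix of block `i + 1`. -/
noncomputable def blockMatrix (size : ℕ → ℕ) (x : ℕ → EuclideanSpace ℝ (Fin d)) (i : ℕ) :
    Matrix (Fin d) (Fin d) ℝ :=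
  ∑ n ∈ block size i, (1 / (size (i + 1) : ℝ)) • vecMulVec (x n).ofLp (x n).ofLp

lemma IsRun.isQR_blockMatrix {size : ℕ → ℕ} {S₀ : Matrix (Fin d) (Fin k) ℝ}
    {x : ℕ → EuclideanSpace ℝ (Fin d)} {Q : ℕ → Matrix (Fin d) (Fin k) ℝ}
    {R : ℕ → Matrix (Fin k) (Fin k) ℝ} (h : IsRun size S₀ x Q R) (i : ℕ) :
    IsQR (blockMatrix size x i * Q i) (Q (i + 1)) (R (i + 1)) := by
  have := h.step i
  simp_rw [← smul_mul, ← Matrix.sum_mul] at this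
  exact this

lemma IsRun.orthonormal {size : ℕ → ℕ} {S₀ : Matrix (Fin d) (Fin k) ℝ}
    {x : ℕ → EuclideanSpace ℝ (Fin d)} {Q : ℕ → Matrix (Fin d) (Fin k) ℝ}
    {R : ℕ → Matrix (Fin k) (Fin k) ℝ} (h : IsRun size S₀ x Q R) (i : ℕ) : (Q i)ᵀ * Q i = 1 := by
  cases i with
  | zero => exact h.init.orthonormal
  | succ i => exact (h.step i).orthonormal

/-- If the initialization and all block matrices are good, the tangent after `i` iterations is at
most `ε_i`. -/
lemma IsRun.tanLE_errBound (hs : SpectralSplit A U W lam lamBar) (h0 : 0 ≤ lamBar)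
    (hl : lamBar < lam) (hd : 0 < d) (hk : 0 < k) (hcb : 0 < cbar) {size : ℕ → ℕ}
    {S₀ : Matrix (Fin d) (Fin k) ℝ} {x : ℕ → EuclideanSpace ℝ (Fin d)}
    {Q : ℕ → Matrix (Fin d) (Fin k) ℝ} {R : ℕ → Matrix (Fin k) (Fin k) ℝ}
    (h : IsRun size S₀ x Q R) (hinit : TanLE U W S₀ (errBound d k cbar lam lamBar 0))
    (hgood : ∀ i v, l2 ((blockMatrix size x i - A) *ᵥ v) ≤
      gap lam lamBar * beta d k cbar lam lamBar (i + 1) * l2 v) (i : ℕ) :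
    TanLE U W (Q i) (errBound d k cbar lam lamBar i) := by
  induction i with
  | zero => exact hinit.of_isQR h.init
  | succ i ih =>
    obtain ⟨h1, h2⟩ := step_ratio_le h0 hl (errBound_pos h0 hl hd hk hcb i)
      (η := gap lam lamBar * beta d k cbar lam lamBar (i + 1)) (by
        rw [beta, Nat.add_sub_cancel])
    have h3 := ih.step hs h0
      (mul_pos (gap_pos h0 hl) (beta_pos h0 hl hd hk hcb (i + 1))).le (h.orthonormal i)
      (hgood i) h1
    rw [errBound_succ]
    exact (h3.mono h2).of_isQR (h.isQR_blockMatrix i)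

/-- The size of block `i + 1` is such that its empirical matrix is within `Δ β` of the covariance
matrix, except with probability `δ_{i+1}`. -/
lemma IsDataLaw.measure_blockMatrix_le {X : Measure (EuclideanSpace ℝ (Fin d))} (hX : IsDataLaw X)
    (h0 : 0 ≤ lamBar) (hl : lamBar < lam) (hd : 2 ≤ d) (hk : 0 < k) (hcb : 0 < cbar)
    (hδ : 0 < δ₀) (hδ1 : δ₀ < 1) (hc : 16 ≤ c) {Ω : Type*} [MeasurableSpace Ω] {P : Measure Ω}
    [IsProbabilityMeasure P] {x : ℕ → Ω → EuclideanSpace ℝ (Fin d)}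
    (hx : ∀ n, HasLaw (x n) X P) (hind : iIndepFun x P) (i : ℕ) :
    P {ω | ¬ ∀ v, l2 ((blockMatrix (blockSize d k δ₀ cbar c lam lamBar) (fun n => x n ω) i
        - covMatrix X) *ᵥ v) ≤ gap lam lamBar * beta d k cbar lam lamBar (i + 1) * l2 v} ≤
      ENNReal.ofReal (failProb δ₀ (i + 1)) := by
  set size := blockSize d k δ₀ cbar c lam lamBar with hsize
  have hr : 0 < gap lam lamBar * beta d k cbar lam lamBar (i + 1) :=
    mul_pos (gap_pos h0 hl) (beta_pos h0 hl (by omega) hk hcb (i + 1))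
  set r := gap lam lamBar * beta d k cbar lam lamBar (i + 1) with hrdef
  have hlog := one_le_log_div_failProb hδ hδ1 hd (Nat.le_add_left 1 i)
  have hle := le_blockSize (δ₀ := δ₀) (c := c) h0 hl (show 0 < d by omega) hk hcb (i + 1)
  have hn : 0 < size (i + 1) := by
    by_contra hneg
    have hz : size (i + 1) = 0 := by omega
    rw [← hsize, hz] at hle
    simp only [Nat.cast_zero, zero_mul] at hle
    nlinarith
  have hcard := card_block size i
  have hne : (block size i).Nonempty := Finset.card_pos.1 (by rw [hcard]; exact hn)
  have h := hX.measure_block_deviation_le hx hind (block size i) hne hr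
  rw [hcard] at h
  refine h.trans (ENNReal.ofReal_le_ofReal ?_)
  set δ := failProb δ₀ (i + 1) with hδdef
  have hδ0 : 0 < δ := failProb_pos hδ (Nat.le_add_left 1 i)
  have hδh : δ ≤ 1 / 2 := failProb_le_half hδ1 (Nat.le_add_left 1 i)
  have hdr : (2 : ℝ) ≤ d := by exact_mod_cast hd
  have hexp : Real.exp (-(size (i + 1) * r ^ 2 / 8)) ≤ (δ / d) ^ 2 := by
    have h1 : (δ / d) ^ 2 = Real.exp (-(2 * Real.log (d / δ))) := by
      rw [← mul_neg, ← Real.log_inv, inv_div, mul_comm, Real.exp_mul, Real.exp_log (by positivity)]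
      norm_num
    rw [h1]
    apply Real.exp_le_exp.2
    nlinarith
  calc 2 * Real.exp (-(size (i + 1) * r ^ 2 / 8)) ≤ 2 * (δ / d) ^ 2 := by linarith
    _ ≤ δ := by
        rw [div_pow, mul_div_assoc', div_le_iff₀ (by positivity)]
        nlinarith [mul_le_mul hdr hdr (by norm_num) (by linarith)]

end Run

end DBPCA

theorem theorem2 :
    -- the threshold for the constant `c` in the block sizes
    ∃ c₀ : ℝ, 0 < c₀ ∧
    -- the failure probability and the constant `c̄` of the initialization
    ∀ δ₀ : ℝ, 0 < δ₀ → δ₀ < 1 →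
    ∃ cbar₀ : ℝ, 0 < cbar₀ ∧
    ∀ cbar : ℝ, 0 < cbar → cbar ≤ cbar₀ →
    ∀ c : ℝ, c₀ ≤ c →
    -- the constant in both bounds
    ∃ C : ℝ, 0 < C ∧
    ∀ (d k : ℕ) (_ : 1 ≤ k) (hkd : k < d)
      (X : Measure (EuclideanSpace ℝ (Fin d))) (_ : DBPCA.IsDataLaw X)
      (ev : Fin d → ℝ) (V : Matrix (Fin d) (Fin d) ℝ)
      (_ : DBPCA.IsSortedEigenbasis (DBPCA.covMatrix X) ev V)
      -- the `k`-th and `(k+1)`-st eigenvalues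
      (lam lamBar : ℝ) (_ : lam = ev ⟨k - 1, by omega⟩) (_ : lamBar = ev ⟨k, hkd⟩)
      (_ : lamBar < lam)
      (ε : ℝ) (_ : 0 < ε) (_ : ε ≤ 1 / Real.sqrt ((k : ℝ) * d)),
    ∃ L : ℕ, 1 ≤ L ∧
      (L : ℝ) ≤ C * (lam / (lam - lamBar) * Real.log (d / ε)) ∧
      -- the total number of samples in the first `L` blocks
      ((∑ i ∈ Finset.Icc 1 L, DBPCA.blockSize d k δ₀ cbar c lam lamBar i : ℕ) : ℝ) ≤
        C * (lam * Real.log (d * L) / (ε ^ 2 * (lam - lamBar) ^ 3)) ∧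
      ∀ {Ω : Type*} [MeasurableSpace Ω] (P : Measure Ω) [IsProbabilityMeasure P]
        (S₀ : Ω → Matrix (Fin d) (Fin k) ℝ) (x : ℕ → Ω → EuclideanSpace ℝ (Fin d))
        (Q : ℕ → Ω → Matrix (Fin d) (Fin k) ℝ) (R : ℕ → Ω → Matrix (Fin k) (Fin k) ℝ),
        -- `S₀` has independent standard normal entries
        (∀ i j, HasLaw (fun ω => S₀ ω i j) (gaussianReal 0 1) P) →
        iIndepFun (fun (p : Fin d × Fin k) ω => S₀ ω p.1 p.2) P →
        -- the data points are independent with common law `X`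
        (∀ n, HasLaw (x n) X P) →
        iIndepFun x P →
        -- the `Q i` are the estimates that the algorithm produces
        (∀ ω, DBPCA.IsRun (DBPCA.blockSize d k δ₀ cbar c lam lamBar) (S₀ ω)
          (fun n => x n ω) (fun i => Q i ω) (fun i => R i ω)) →
        P {ω | ∃ i, L ≤ i ∧ ε < DBPCA.sinAngle (DBPCA.firstCols hkd.le V) (Q i ω)} ≤
          ENNReal.ofReal (2 * δ₀) := by
  -- `c₀ = 16` bounds the failure probability of a block by `2 (δ_i / d) ^ 2`; the threshold for
  -- `c̄` is the one at which `√(d k / c̄)` is the tangent bound of the Gaussian initialization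
  refine ⟨16, by norm_num, fun δ₀ hδ hδ1 => ⟨(3 * δ₀ / 32) ^ 3 / 4, by positivity,
    fun cbar hcb hcbar c hc => ?_⟩⟩
  have hτ1 : (3 * δ₀ / 32) ^ 3 ≤ 1 := pow_le_one₀ (by positivity) (by linarith)
  have hcb1 : cbar ≤ 1 := by linarith
  set C₁ := 8 + 12 * Real.log (1 / cbar)
  set C₂ := 456 * c * (2 + 2 * Real.log (2 / δ₀)) * (1 / cbar + 1)
  refine ⟨max C₁ C₂, lt_max_of_lt_left ?_, ?_⟩
  · have : 0 ≤ Real.log (1 / cbar) := Real.log_nonneg ((one_le_div hcb).2 hcb1)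
    positivity
  intro d k hk hkd X hX ev V hV lam lamBar hlam hlamBar hl ε hε hεd
  have hA : (DBPCA.covMatrix X)ᵀ = DBPCA.covMatrix X := DBPCA.covMatrix_transpose
  have h0 : 0 ≤ lamBar := hlamBar ▸ hX.eigenvalue_nonneg hV _
  have hl1 : lam ≤ 1 := hlam ▸ hX.eigenvalue_le_one hV _
  have hd2 : 2 ≤ d := by omega
  have hdr : (2 : ℝ) ≤ d := by exact_mod_cast hd2
  have hsub : 0 < lam - lamBar := by linarith
  have hlam0 : 0 < lam := by linarith
  obtain ⟨L, hL1, hLε, hLle, hN⟩ := DBPCA.exists_iteration_count h0 hl hl1 hk hkd hcb hcb1 hδ hδ1 hc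
    hε hεd
  have hLr : (1 : ℝ) ≤ L := by exact_mod_cast hL1
  refine ⟨L, hL1, hLle.trans ?_, hN.trans ?_, ?_⟩
  · refine mul_le_mul_of_nonneg_right (le_max_left _ _) (mul_nonneg (by positivity) ?_)
    apply Real.log_nonneg
    rw [one_le_div hε]
    refine hεd.trans (le_trans ?_ (by linarith : (1 : ℝ) ≤ d))
    rw [div_le_one (Real.sqrt_pos.2 (by positivity))]
    apply Real.one_le_sqrt.2
    have : (1 : ℝ) ≤ k := by exact_mod_cast hk
    nlinarith
  · refine mul_le_mul_of_nonneg_right (le_max_right _ _) (div_nonneg (mul_nonneg (by linarith) ?_)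
      (by positivity))
    apply Real.log_nonneg
    nlinarith
  intro Ω _ P _ S₀ x Q R hS hSind hx hxind hrun
  have hs : DBPCA.SpectralSplit (DBPCA.covMatrix X) (DBPCA.firstCols hkd.le V)
      (DBPCA.lastCols k V) lam lamBar := by
    rw [hlam, hlamBar]
    exact hV.spectralSplit hA hkd.le (hX.eigenvalue_nonneg hV) (Nat.sub_add_cancel hk) rfl
  set U := DBPCA.firstCols hkd.le V
  set W := DBPCA.lastCols k V
  set bad : ℕ → Set Ω := fun i => {ω | ¬ ∀ v, DBPCA.l2 ((DBPCA.blockMatrix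
    (DBPCA.blockSize d k δ₀ cbar c lam lamBar) (fun n => x n ω) i - DBPCA.covMatrix X) *ᵥ v) ≤
      DBPCA.gap lam lamBar * DBPCA.beta d k cbar lam lamBar (i + 1) * DBPCA.l2 v}
  set badInit : Set Ω := {ω | ¬ DBPCA.TanLE U W (S₀ ω)
    (Real.sqrt (4 * (k * (1 / (3 * δ₀ / 32) ^ 3 * d))))}
  have hsubset : {ω | ∃ i, L ≤ i ∧ ε < DBPCA.sinAngle U (Q i ω)} ⊆ badInit ∪ ⋃ i, bad i := by
    rintro ω ⟨i, hLi, hi⟩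
    by_contra hcon
    rw [Set.mem_union, not_or, Set.mem_iUnion, not_exists] at hcon
    obtain ⟨hinit, hblock⟩ := hcon
    have hinit' : DBPCA.TanLE U W (S₀ ω) (DBPCA.errBound d k cbar lam lamBar 0) := by
      refine (not_not.1 hinit).mono ?_
      rw [DBPCA.errBound, pow_zero, mul_one]
      apply Real.sqrt_le_sqrt
      rw [le_div_iff₀ hcb]
      calc 4 * (k * (1 / (3 * δ₀ / 32) ^ 3 * d)) * cbar
          ≤ 4 * (k * (1 / (3 * δ₀ / 32) ^ 3 * d)) * ((3 * δ₀ / 32) ^ 3 / 4) :=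
            mul_le_mul_of_nonneg_left hcbar (by positivity)
        _ = d * k := by field_simp
    have htan := (hrun ω).tanLE_errBound hs h0 hl (by omega) hk hcb hinit'
      (fun i => not_not.1 (hblock i)) i
    have hsin := htan.sinAngle_le hs (DBPCA.errBound_pos h0 hl (by omega) hk hcb i).le
      ((hrun ω).orthonormal i)
    have := DBPCA.errBound_antitone (d := d) (k := k) (cbar := cbar) h0 hl hLi
    linarith
  calc P {ω | ∃ i, L ≤ i ∧ ε < DBPCA.sinAngle U (Q i ω)}
      ≤ P badInit + P (⋃ i, bad i) := (measure_mono hsubset).trans (measure_union_le _ _)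
    _ ≤ ENNReal.ofReal δ₀ + ∑' i, P (bad i) := by
        refine add_le_add ?_ (measure_iUnion_le _)
        exact DBPCA.measure_not_tanLE_gaussian_le hS hSind (by omega) hk hs
          (DBPCA.firstCols_orthonormal hkd.le hV.orthonormal) hδ
    _ ≤ ENNReal.ofReal δ₀ + ENNReal.ofReal δ₀ := by
        refine add_le_add le_rfl ((ENNReal.tsum_le_tsum fun i => ?_).trans
          (DBPCA.tsum_failProb_le hδ))
        exact hX.measure_blockMatrix_le h0 hl hd2 hk hcb hδ hδ1 hc hx hxind i
    _ = ENNReal.ofReal (2 * δ₀) := by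
        rw [← ENNReal.ofReal_add hδ.le hδ.le, two_mul]
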